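/- A nodal tropical plane curve $\Gamma$ is the curve in $\mathbb{R}^2$ defined by a tropical (max-plus) Laurent polynomial $\max_{u\in A}(c_u+\langle u,x\rangle)$ ($A\subset\mathbb{Z}^2$ finite) whose Newton polygon is two-dimensional and is divided, by the regular subdivision induced by the coefficients, into lattice triangles of area $1/2$ and lattice parallelograms of area $1$ only. The points of $\Gamma$ dual to the parallelograms are its nodes. Regard $\Gamma$ as an immersion of an abstract polyhedral complex: its vertices are the points dual to the triangles, and at a node two edges of the complex merely cross (the node is not a vertex). The skeleton of $\Gamma$ is the multigraph (loops and multiple edges allowed) obtained from this complex by removing all rays, iteratively removing the vertices of degree $1$ together with their edges, and smoothing over all $2$-valent vertices; here a contractible connected component of the complex contributes a single point, and a component with first Betti number $1$ contributes a cycle. The $2$-connected components of a graph are the connected components of the graph obtained by deleting all bridges. Let $\Gamma$ be a nodal tropical plane curve whose skeleton $G$ is a $3$-regular graph, with $2$-connected components $G_1,\dots,G_s$, and let $i\neq j$. If $G_i$ and $G_j$ meet in a node $p$ of $\Gamma$ (that is, $p$ lies both on the part of the curve formed by $G_i$ and on the part formed by $G_j$), then there is a node $q\neq p$ of $\Gamma$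 in which $G_i$ and $G_j$ also meet. -/

import Mathlib

/-! ## Connectivity of multigraphs

Mathlib's `Graph α β` is a multigraph with loops allowed. -/

/-- The degree of a vertex, loops being counted twice. -/
noncomputable def multigraphDegree {α β : Type*} (G : Graph α β) (v : α) : ℕ∞ :=
  {e | G.IsNonloopAt e v}.encard + 2 * {e | G.IsLoopAt e v}.encard

/-- Every vertex has degree `3`. -/
def IsThreeRegular {α β : Type*} (G : Graph α β) : Prop :=
  ∀ v ∈ G.vertexSet, multigraphDegree G v = 3

/-- `v` and `w` are joined by a walk in `G`. -/
def Reachable {α β : Type*} (G : Graph α β) (v w : α) : Prop :=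
  Relation.ReflTransGen G.Adj v w

/-- An edge is a bridge if removing it disconnects two vertices that were connected
(that is, if the removal increases the number of connected components). -/
def IsBridge {α β : Type*} (G : Graph α β) (e : β) : Prop :=
  e ∈ G.edgeSet ∧ ∃ v ∈ G.vertexSet, ∃ w ∈ G.vertexSet,
    Reachable G v w ∧ ¬ Reachable (G.deleteEdges {e}) v w

/-- `K` is a connected component of `G`: the subgraph of `G` induced on the set of
all vertices reachable from some vertex of `G`. -/
def IsConnectedComponent {α β : Type*} (G K : Graph α β) : Prop :=
  ∃ v ∈ G.vertexSet, K = G.induce {w | Reachable G v w}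

/-- The 2-connected components of `G` are the connected components of the graph obtained
from `G` by deleting all bridges. -/
def IsTwoConnectedComponent {α β : Type*} (G K : Graph α β) : Prop :=
  IsConnectedComponent (G.deleteEdges {e | IsBridge G e}) K

/-! ## Tropical polynomials and nodal tropical plane curves -/

/-- A tropical (Laurent) polynomial in two variables, with the max convention:
`support` is the finite set of the exponents whose coefficient is not `-∞`, and
`coeff u` is the coefficient of such an exponent `u` (other values of `coeff` are not used). -/
structure TropicalPolynomial where
  support : Finset (ℤ × ℤ)
  coeff : ℤ × ℤ → ℝ

/-- Twice the signed area of the lattice triangle `u v w`. -/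
def latticeDet (u v w : ℤ × ℤ) : ℤ :=
  (v.1 - u.1) * (w.2 - u.2) - (v.2 - u.2) * (w.1 - u.1)

/-- The convex hull of `s` has dimension at most one. -/
def IsCollinear (s : Set (ℤ × ℤ)) : Prop :=
  ∀ u ∈ s, ∀ v ∈ s, ∀ w ∈ s, latticeDet u v w = 0

namespace TropicalPolynomial

/-- The value at `x` of the term with exponent `u`. -/
noncomputable def term (F : TropicalPolynomial) (u : ℤ × ℤ) (x : ℝ × ℝ) : ℝ :=
  F.coeff u + u.1 * x.1 + u.2 * x.2

/-- The exponents at which the maximum over all terms is attained at `x`. The tropical curve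
of `F` is the set of the `x` for which this set has at least two elements; the convex
hulls of the sets `F.argmax x` are the cells (polygons, edges, vertices) of the regular
subdivision of the Newton polygon of `F` that is induced by the coefficients. -/
def argmax (F : TropicalPolynomial) (x : ℝ × ℝ) : Set (ℤ × ℤ) :=
  {u | u ∈ F.support ∧ ∀ v ∈ F.support, F.term v x ≤ F.term u x}

/-- The cell dual to `x` is a triangle of area `1/2`. (The only lattice points of such a
triangle are its vertices.) -/
def IsTriangle (F : TropicalPolynomial) (x : ℝ × ℝ) : Prop :=
  ∃ u v w : ℤ × ℤ, F.argmax x = {u, v, w} ∧ |latticeDet u v w| = 1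

/-- `x` is a node: the cell dual to `x` is a parallelogram of area `1`. (The only lattice
points of such a parallelogram are its vertices.) -/
def IsNode (F : TropicalPolynomial) (x : ℝ × ℝ) : Prop :=
  ∃ u a b : ℤ × ℤ, F.argmax x = {u, u + a, u + b, u + a + b} ∧
    |latticeDet u (u + a) (u + b)| = 1

end TropicalPolynomial

/-- A nodal tropical plane curve, given by a tropical polynomial whose Newton polygon is
two-dimensional and is subdivided into triangles of area `1/2` and parallelograms of area `1`:
all two-dimensional cells of the dual subdivision are of these two kinds. -/
structure NodalTropicalCurve extends TropicalPolynomial where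
  newton_twoDimensional : ¬ IsCollinear (support : Set (ℤ × ℤ))
  nodal : ∀ x : ℝ × ℝ, ¬ IsCollinear (toTropicalPolynomial.argmax x) →
    toTropicalPolynomial.IsTriangle x ∨ toTropicalPolynomial.IsNode x

namespace NodalTropicalCurve

/-- The one-dimensional cells (edges and rays) of the tropical curve as a subset of the plane,
recorded by their dual edges in the subdivision of the Newton polygon. -/
def Cell (Γ : NodalTropicalCurve) : Type :=
  {s : Set (ℤ × ℤ) // (∃ x, Γ.argmax x = s) ∧ s.Nontrivial ∧ IsCollinear s}

/-- The closed segment, closed ray or line in the plane that is dual to an edge `s` of the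
subdivision. -/
def cellSet (Γ : NodalTropicalCurve) (s : Γ.Cell) : Set (ℝ × ℝ) :=
  {x | s.1 ⊆ Γ.argmax x}

/-- Two cells continue each other straight through a node: they are dual to opposite sides of
the parallelogram of the node. -/
def ContinueThroughNode (Γ : NodalTropicalCurve) (s t : Γ.Cell) : Prop :=
  ∃ p, Γ.IsNode p ∧ s.1 ⊆ Γ.argmax p ∧ t.1 ⊆ Γ.argmax p ∧ Disjoint s.1 t.1

/-- The edges and rays of the abstract polyhedral complex of which the curve is an immersion:
the nodes are not part of this complex, so the cells which continue each other through nodes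
form one edge. -/
def Strand (Γ : NodalTropicalCurve) : Type :=
  Quot Γ.ContinueThroughNode

/-- The strand to which a cell belongs. -/
def strandOf (Γ : NodalTropicalCurve) (s : Γ.Cell) : Γ.Strand :=
  Quot.mk _ s

/-- A flag of the abstract complex: an end of a strand at a vertex. The vertices of the
abstract complex are the points dual to triangles; each of them lies on the three cells dual
to the sides of the triangle. -/
structure Flag (Γ : NodalTropicalCurve) where
  vertex : ℝ × ℝ
  cell : Γ.Cell
  isTriangle : Γ.IsTriangle vertex
  mem : vertex ∈ Γ.cellSet cell

/-- The strand of which a flag is an end. -/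
def Flag.strand {Γ : NodalTropicalCurve} (d : Γ.Flag) : Γ.Strand :=
  Γ.strandOf d.cell

/-! ## The skeleton -/

/-- The strands that are removed on the way to the skeleton: all unbounded strands (those
without two ends), and then iteratively each strand one of whose end vertices has no other
remaining flag, that is, has become a vertex of degree `1`. -/
inductive IsPruned (Γ : NodalTropicalCurve) : Γ.Strand → Prop
  | unbounded (σ : Γ.Strand)
      (h : ∀ d d' : Γ.Flag, d.strand = σ → d'.strand = σ → d = d') : IsPruned Γ σ
  | leaf (d : Γ.Flag)
      (h : ∀ d' : Γ.Flag, d'.vertex = d.vertex → d' ≠ d → IsPruned Γ d'.strand) :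
      IsPruned Γ d.strand

/-- The strands that remain. -/
def CoreStrand (Γ : NodalTropicalCurve) : Type :=
  {σ : Γ.Strand // ¬ Γ.IsPruned σ}

/-- The degree of a vertex in what remains after the pruning. -/
noncomputable def coreDegree (Γ : NodalTropicalCurve) (x : ℝ × ℝ) : ℕ∞ :=
  {d : Γ.Flag | d.vertex = x ∧ ¬ Γ.IsPruned d.strand}.encard

/-- Two remaining strands meet at a vertex of degree `2`. -/
def MeetAtTwoValent (Γ : NodalTropicalCurve) (σ τ : Γ.CoreStrand) : Prop :=
  ∃ d d' : Γ.Flag, d ≠ d' ∧ d.vertex = d'.vertex ∧ Γ.coreDegree d.vertex = 2 ∧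
    d.strand = σ.1 ∧ d'.strand = τ.1

/-- The edges of the skeleton: smoothing over the `2`-valent vertices joins the remaining
strands that meet there into one edge. -/
def SkeletonEdge (Γ : NodalTropicalCurve) : Type :=
  Quot Γ.MeetAtTwoValent

/-- The skeleton edge to which a remaining strand belongs. -/
def skeletonEdgeOf (Γ : NodalTropicalCurve) (σ : Γ.CoreStrand) : Γ.SkeletonEdge :=
  Quot.mk _ σ

/-- The flag `d` is an end of the skeleton edge `e` at a vertex of degree `3` of the
skeleton. -/
def IsEnd (Γ : NodalTropicalCurve) (e : Γ.SkeletonEdge) (d : Γ.Flag) : Prop :=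
  Γ.coreDegree d.vertex = 3 ∧
    ∃ h : ¬ Γ.IsPruned d.strand, Γ.skeletonEdgeOf ⟨d.strand, h⟩ = e

/-- Two strands meet at a vertex of the abstract complex. -/
def Meet (Γ : NodalTropicalCurve) (σ τ : Γ.Strand) : Prop :=
  ∃ d d' : Γ.Flag, d.vertex = d'.vertex ∧ d.strand = σ ∧ d'.strand = τ

/-- The connected components of the abstract complex. -/
def Component (Γ : NodalTropicalCurve) : Type :=
  Quot Γ.Meet

/-- Names for the vertices of the skeleton: `branch x` for a trivalent point `x`; `circle e`
for a vertex placed on a skeleton edge `e` which closes up to a circle (first Betti number `1`);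
`point c` for the single point to which a contractible component `c` of the complex
retracts (first Betti number `0`). -/
inductive SkeletonVertex (Γ : NodalTropicalCurve) : Type
  | branch (x : ℝ × ℝ)
  | circle (e : Γ.SkeletonEdge)
  | point (c : Γ.Component)

/-- Which of these names are vertices of the skeleton. -/
def IsSkeletonVertex (Γ : NodalTropicalCurve) : Γ.SkeletonVertex → Prop
  | .branch x => Γ.coreDegree x = 3
  | .circle e => ∀ d, ¬ Γ.IsEnd e d
  | .point c => ∀ σ : Γ.CoreStrand, (Quot.mk _ σ.1 : Γ.Component) ≠ c

/-- The edge `e` of the skeleton has the ends `v` and `w`: either its two ends are flags at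
trivalent points, or it is a circle, made into a loop at its vertex. -/
def IsSkeletonLink (Γ : NodalTropicalCurve) (e : Γ.SkeletonEdge) (v w : Γ.SkeletonVertex) :
    Prop :=
  (∃ d d' : Γ.Flag, d ≠ d' ∧ {f | Γ.IsEnd e f} = {d, d'} ∧
    v = .branch d.vertex ∧ w = .branch d'.vertex) ∨
  ((∀ d, ¬ Γ.IsEnd e d) ∧ v = .circle e ∧ w = .circle e)

/-- The skeleton of a nodal tropical curve, as a finite (non-metric) multigraph: remove all
rays from the abstract complex, iteratively remove the vertices of degree `1` with their edge,
and smooth over all `2`-valent vertices. -/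
def skeleton (Γ : NodalTropicalCurve) : Graph Γ.SkeletonVertex Γ.SkeletonEdge where
  vertexSet := {v | Γ.IsSkeletonVertex v}
  IsLink := Γ.IsSkeletonLink
  isLink_symm := by
    rintro e -
    refine ⟨fun v w h => ?_⟩
    rcases h with ⟨d, d', hne, hset, rfl, rfl⟩ | ⟨h, rfl, rfl⟩
    · exact Or.inl ⟨d', d, hne.symm, by rw [hset, Set.pair_comm], rfl, rfl⟩
    · exact Or.inr ⟨h, rfl, rfl⟩
  eq_or_eq_of_isLink_of_isLink := by
    rintro e x y v w h h'
    rcases h with ⟨d, d', hne, hset, rfl, rfl⟩ | ⟨h, rfl, rfl⟩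
    · rcases h' with ⟨f, f', hne', hset', rfl, rfl⟩ | ⟨h', rfl, rfl⟩
      · have hd : d ∈ ({f, f'} : Set Γ.Flag) := by
          rw [← hset', hset]; exact Or.inl rfl
        rcases hd with rfl | rfl
        · exact Or.inl rfl
        · exact Or.inr rfl
      · have hd : d ∈ {f | Γ.IsEnd e f} := by rw [hset]; exact Or.inl rfl
        exact absurd hd (h' d)
    · rcases h' with ⟨f, f', hne', hset', rfl, rfl⟩ | ⟨h', rfl, rfl⟩
      · have hf : f ∈ {f | Γ.IsEnd e f} := by rw [hset']; exact Or.inl rfl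
        exact absurd hf (h f)
      · exact Or.inl rfl
  left_mem_of_isLink := by
    rintro e x y (⟨d, d', hne, hset, rfl, rfl⟩ | ⟨h, rfl, rfl⟩)
    · have hd : d ∈ {f | Γ.IsEnd e f} := by rw [hset]; exact Or.inl rfl
      exact hd.1
    · exact h

/-- The part of the tropical curve in the plane that is formed by a subgraph `K` of the
skeleton: all cells which belong to the edges of `K`, and the trivalent points which are
vertices of `K`. -/
def image (Γ : NodalTropicalCurve) (K : Graph Γ.SkeletonVertex Γ.SkeletonEdge) :
    Set (ℝ × ℝ) :=
  {x | (∃ (s : Γ.Cell) (h : ¬ Γ.IsPruned (Γ.strandOf s)),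
      Γ.skeletonEdgeOf ⟨Γ.strandOf s, h⟩ ∈ K.edgeSet ∧ x ∈ Γ.cellSet s) ∨
    SkeletonVertex.branch x ∈ K.vertexSet}

end NodalTropicalCurve

/-! The statement is one of parity: two cycles modulo 2 in the plane that meet only in transversal
crossings cross an even number of times. An edge of a 2-connected component is not a bridge, so it
lies on a cycle modulo 2 inside this component (`exists_cycle`). Take such a cycle `f` in one
component and `g` in the other, both passing through `p`. Distinct components share no vertex and no
edge, so `f` and `g` meet only in nodes; if `p` were the only common node, they would cross exactly
once.

The parity is proved on the dual subdivision. There `f` is a cocycle: its values on the sides of a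
triangle add up to zero, and opposite sides of a parallelogram have equal values. Hence it is the
coboundary of a potential `c` on the exponents, that is, of a two-colouring of the complementary
regions of the curve (`IsCocycle.exists_potential`). Since `f` vanishes on the cells of `g`, the
colour is the same on both sides of such a cell, and the cell gets the weight `g` times this colour.
Every cell of the skeleton has exactly two ends (`Cell.ends_eq_pair`), so the sum of the weights
over all triangles and nodes is zero (`sum_vertexSum`). The local sum is zero at a triangle and is
the crossing number of `f` and `g` modulo 2 at a node. A single crossing would make the total one.

The potential is built by adding exponents in descending order of a linear form with irrational
slope. The values that the upward edges force at a new exponent agree because the upper part of the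
boundary of its region is connected (`isPreconnected_upperBoundary`). -/

open Filter Topology

/-! ### Lattice determinants, maximal terms and sides of cells -/

theorem latticeDet_add (u a b : ℤ × ℤ) :
    latticeDet u (u + a) (u + b) = a.1 * b.2 - a.2 * b.1 := by
  simp [latticeDet]

theorem latticeDet_swap (u v w : ℤ × ℤ) : latticeDet v u w = -latticeDet u v w := by
  simp only [latticeDet]; ring

theorem latticeDet_swap_right (u v w : ℤ × ℤ) : latticeDet u w v = -latticeDet u v w := by
  simp only [latticeDet]; ring

namespace TropicalPolynomial

variable {F : TropicalPolynomial} {x y : ℝ × ℝ} {u v w : ℤ × ℤ}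

/-- A direction vector of the line on which the terms `u` and `v` agree. -/
def edgeDir (u v : ℤ × ℤ) : ℝ × ℝ := ((u.2 : ℝ) - v.2, (v.1 : ℝ) - u.1)

/-- Along the line dual to `u` and `v`, a term gains on `u` at a rate given by the side of `u v` on
which its exponent lies. The arguments about ends of edges rest on this identity. -/
theorem term_add_smul_edgeDir (F : TropicalPolynomial) (u v w : ℤ × ℤ) (x : ℝ × ℝ) (r : ℝ) :
    F.term w (x + r • edgeDir u v) - F.term u (x + r • edgeDir u v) =
      F.term w x - F.term u x + r * latticeDet u v w := by
  simp only [term, edgeDir, latticeDet, Prod.fst_add, Prod.snd_add, Prod.smul_fst, Prod.smul_snd,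
    smul_eq_mul]
  push_cast
  ring

theorem argmax_subset (F : TropicalPolynomial) (x : ℝ × ℝ) : F.argmax x ⊆ F.support :=
  fun _ h => h.1

theorem term_eq (hu : u ∈ F.argmax x) (hv : v ∈ F.argmax x) : F.term u x = F.term v x :=
  le_antisymm (hv.2 u hu.1) (hu.2 v hv.1)

theorem mem_argmax_of_le (hu : u ∈ F.argmax x) (hv : v ∈ F.support)
    (h : F.term u x ≤ F.term v x) : v ∈ F.argmax x :=
  ⟨hv, fun w hw => (hu.2 w hw).trans h⟩

theorem term_lt (hu : u ∈ F.argmax x) (hv : v ∈ F.support) (h : v ∉ F.argmax x) :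
    F.term v x < F.term u x := by
  by_contra! h'
  exact h (mem_argmax_of_le hu hv h')

theorem continuous_term (F : TropicalPolynomial) (u : ℤ × ℤ) : Continuous (F.term u) := by
  unfold term; fun_prop

theorem exists_eq_add_smul_edgeDir (huv : u ≠ v) (hx : F.term u x = F.term v x)
    (hy : F.term u y = F.term v y) : ∃ r : ℝ, y = x + r • edgeDir u v := by
  have hpos : ((u.2 : ℝ) - v.2) ^ 2 + ((v.1 : ℝ) - u.1) ^ 2 ≠ 0 := by
    intro h
    apply huv
    have h1 : ((u.2 : ℝ) - v.2) = 0 := by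
      nlinarith [sq_nonneg ((u.2 : ℝ) - v.2), sq_nonneg ((v.1 : ℝ) - u.1)]
    have h2 : ((v.1 : ℝ) - u.1) = 0 := by
      nlinarith [sq_nonneg ((u.2 : ℝ) - v.2), sq_nonneg ((v.1 : ℝ) - u.1)]
    ext
    · exact_mod_cast (sub_eq_zero.1 h2).symm
    · exact_mod_cast sub_eq_zero.1 h1
  have key : ((v.1 : ℝ) - u.1) * (y.1 - x.1) = ((u.2 : ℝ) - v.2) * (y.2 - x.2) := by
    simp only [term] at hx hy
    linarith
  -- The parameter is the coefficient of the orthogonal projection of `y - x` to the direction of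
  -- the line.
  refine ⟨(((u.2 : ℝ) - v.2) * (y.1 - x.1) + ((v.1 : ℝ) - u.1) * (y.2 - x.2)) /
    (((u.2 : ℝ) - v.2) ^ 2 + ((v.1 : ℝ) - u.1) ^ 2), ?_⟩
  ext
  · simp only [edgeDir, Prod.fst_add, Prod.smul_fst, smul_eq_mul]
    field_simp
    linear_combination ((v.1 : ℝ) - u.1) * key
  · simp only [edgeDir, Prod.snd_add, Prod.smul_snd, smul_eq_mul]
    field_simp
    linear_combination - ((u.2 : ℝ) - v.2) * key

/-- The set of the maximal terms is upper semicontinuous. -/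
theorem eventually_argmax_subset (F : TropicalPolynomial) (x : ℝ × ℝ) :
    ∀ᶠ y in 𝓝 x, F.argmax y ⊆ F.argmax x := by
  have h : ∀ᶠ y in 𝓝 x, ∀ v ∈ F.support, v ∉ F.argmax x → v ∉ F.argmax y := by
    rw [F.support.eventually_all]
    intro v hv
    by_cases hvx : v ∈ F.argmax x
    · simp [hvx]
    · obtain ⟨u, hu, huv⟩ : ∃ u ∈ F.support, F.term v x < F.term u x := by
        by_contra! h
        exact hvx ⟨hv, h⟩
      filter_upwards [(F.continuous_term v).continuousAt.eventually_lt
        (F.continuous_term u).continuousAt huv] with y hy _ hvy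
      exact absurd (hvy.2 u hu) (not_le.2 hy)
  filter_upwards [h] with y hy v hv
  by_contra hvx
  exact hy v hv.1 hvx hv

/-- The set of the maximal terms has two elements, and thus is an edge of the subdivision. -/
def IsEdge (F : TropicalPolynomial) (u v : ℤ × ℤ) : Prop :=
  u ≠ v ∧ ∃ x, F.argmax x = {u, v}

theorem IsEdge.symm (h : F.IsEdge u v) : F.IsEdge v u :=
  ⟨h.1.symm, by simpa only [Set.pair_comm] using h.2⟩

/-- A side of a cell of the subdivision is an edge of the subdivision. -/
theorem isEdge_of_side (hu : u ∈ F.argmax x) (hv : v ∈ F.argmax x) (huv : u ≠ v)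
    (h : ∀ w ∈ F.argmax x, w ≠ u → w ≠ v → 0 < latticeDet u v w) : F.IsEdge u v := by
  refine ⟨huv, ?_⟩
  have hc : Tendsto (fun r : ℝ => x + r • edgeDir u v) (𝓝 0) (𝓝 x) := by
    have : Continuous (fun r : ℝ => x + r • edgeDir u v) := by fun_prop
    simpa using this.tendsto 0
  -- A short step with `r < 0` makes every other maximal term fall below `u`, since its exponent
  -- lies on the positive side; by semicontinuity no new term becomes maximal.
  have hev := ((hc.eventually (F.eventually_argmax_subset x)).filter_mono
    (nhdsWithin_le_nhds (s := Set.Iio 0))).and self_mem_nhdsWithin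
  obtain ⟨r, hr, hr0⟩ := hev.exists
  have hr0 : r < 0 := hr0
  set y := x + r • edgeDir u v with hy
  have hdiff : ∀ w ∈ F.argmax x, F.term w y - F.term u y = r * latticeDet u v w := by
    intro w hw
    rw [hy, term_add_smul_edgeDir, term_eq hw hu]; ring
  have hvy : F.term v y = F.term u y := by
    have := hdiff v hv
    have h0 : latticeDet u v v = 0 := by simp only [latticeDet]; ring
    rw [h0] at this
    simp at this
    linarith
  have hlt : ∀ w ∈ F.argmax x, w ≠ u → w ≠ v → F.term w y < F.term u y := by
    intro w hw h1 h2
    have h3 : (0 : ℝ) < latticeDet u v w := by exact_mod_cast h w hw h1 h2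
    have := hdiff w hw
    nlinarith
  obtain ⟨m, hm, hmax⟩ := F.support.exists_max_image (fun w => F.term w y) ⟨u, hu.1⟩
  have hmy : m ∈ F.argmax y := ⟨hm, hmax⟩
  have hmu : F.term m y ≤ F.term u y := by
    by_cases h1 : m = u
    · rw [h1]
    by_cases h2 : m = v
    · rw [h2, hvy]
    exact (hlt m (hr hmy) h1 h2).le
  have huy : u ∈ F.argmax y := mem_argmax_of_le hmy hu.1 hmu
  refine ⟨y, Set.Subset.antisymm ?_ ?_⟩
  · intro w hw
    by_contra hne
    simp only [Set.mem_insert_iff, Set.mem_singleton_iff, not_or] at hne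
    exact absurd (term_eq hw huy) (hlt w (hr hw) hne.1 hne.2).ne
  · rintro w (rfl | rfl)
    · exact huy
    · exact mem_argmax_of_le huy hv.1 hvy.ge

theorem isEdge_of_side' (hu : u ∈ F.argmax x) (hv : v ∈ F.argmax x) (huv : u ≠ v)
    (h : (∀ w ∈ F.argmax x, w ≠ u → w ≠ v → 0 < latticeDet u v w) ∨
      (∀ w ∈ F.argmax x, w ≠ u → w ≠ v → latticeDet u v w < 0)) : F.IsEdge u v := by
  rcases h with h | h
  · exact isEdge_of_side hu hv huv h
  · refine (isEdge_of_side hv hu huv.symm fun w hw h1 h2 => ?_).symm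
    rw [latticeDet_swap]
    linarith [h w hw h2 h1]

theorem IsTriangle.corner (h : F.IsTriangle x) (hu : u ∈ F.argmax x) :
    ∃ v w, F.argmax x = {u, v, w} ∧ |latticeDet u v w| = 1 := by
  obtain ⟨a, b, c, hx, hd⟩ := h
  rw [hx] at hu
  rcases hu with rfl | rfl | rfl
  · exact ⟨b, c, hx, hd⟩
  · refine ⟨a, c, by rw [hx, Set.insert_comm], ?_⟩
    rwa [latticeDet_swap, abs_neg]
  · refine ⟨a, b, by rw [hx]; ext; simp; tauto, ?_⟩
    rw [← hd]; congr 1; simp only [latticeDet]; ring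

/-- Seen from another corner, a parallelogram has the same spanning vectors up to sign. -/
theorem IsNode.corner (h : F.IsNode x) (hu : u ∈ F.argmax x) :
    ∃ a b, F.argmax x = {u, u + a, u + b, u + a + b} ∧
      |latticeDet u (u + a) (u + b)| = 1 := by
  obtain ⟨c, a, b, hx, hd⟩ := h
  rw [latticeDet_add] at hd
  rw [hx] at hu
  simp only [latticeDet_add]
  rcases hu with rfl | rfl | rfl | rfl
  · exact ⟨a, b, hx, hd⟩
  · refine ⟨-a, b, ?_, ?_⟩
    · rw [hx]; ext z; simp [add_assoc]; tauto
    · rw [← hd, ← abs_neg]; congr 1; simp; ring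
  · refine ⟨a, -b, ?_, ?_⟩
    · rw [hx, show c + b + a = c + a + b by abel, show c + b + -b = c by abel,
        show c + a + b + -b = c + a by abel]; ext z; simp; tauto
    · rw [← hd, ← abs_neg]; congr 1; simp; ring
  · refine ⟨-a, -b, ?_, ?_⟩
    · rw [hx, show c + a + b + -a = c + b by abel, show c + a + b + -b = c + a by abel,
        show c + b + -b = c by abel]; ext z; simp; tauto
    · rw [← hd]; congr 1; simp

theorem IsNode.swap {a b : ℤ × ℤ} (h : F.argmax x = {u, u + a, u + b, u + a + b})
    (hd : |latticeDet u (u + a) (u + b)| = 1) :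
    F.argmax x = {u, u + b, u + a, u + b + a} ∧ |latticeDet u (u + b) (u + a)| = 1 := by
  refine ⟨?_, by rwa [latticeDet_swap_right, abs_neg]⟩
  rw [h, add_right_comm u b a]; ext z; simp; tauto

end TropicalPolynomial

theorem isCollinear_of_latticeDet_eq_zero {u v : ℤ × ℤ} {s : Set (ℤ × ℤ)} (huv : u ≠ v)
    (h : ∀ w ∈ s, latticeDet u v w = 0) : IsCollinear s := by
  intro w₁ h₁ w₂ h₂ w₃ h₃
  have e₁ := h w₁ h₁
  have e₂ := h w₂ h₂
  have e₃ := h w₃ h₃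
  simp only [latticeDet] at *
  have hn : v.1 - u.1 ≠ 0 ∨ v.2 - u.2 ≠ 0 := by
    by_contra! hn
    exact huv (Prod.ext (by linarith) (by linarith))
  rcases hn with hn | hn
  · apply mul_left_cancel₀ hn
    linear_combination (w₂.1 - w₁.1) * (e₃ - e₁) - (w₃.1 - w₁.1) * (e₂ - e₁)
  · apply mul_left_cancel₀ hn
    linear_combination (w₂.2 - w₁.2) * (e₃ - e₁) - (w₃.2 - w₁.2) * (e₂ - e₁)

theorem ne_of_abs_latticeDet_eq_one {u v w : ℤ × ℤ} (h : |latticeDet u v w| = 1) :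
    u ≠ v ∧ u ≠ w ∧ v ≠ w := by
  refine ⟨?_, ?_, ?_⟩ <;> rintro rfl <;> simp [latticeDet, mul_comm] at h

theorem parallelogram_ne {u a b : ℤ × ℤ} (h : |latticeDet u (u + a) (u + b)| = 1) :
    a ≠ 0 ∧ b ≠ 0 ∧ a ≠ b ∧ a + b ≠ 0 := by
  rw [latticeDet_add] at h
  refine ⟨?_, ?_, ?_, ?_⟩
  · rintro rfl; simp at h
  · rintro rfl; simp at h
  · rintro rfl; simp [mul_comm] at h
  · intro h0
    obtain rfl : b = -a := by rw [← sub_eq_zero, ← h0]; abel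
    simp [mul_comm] at h

/-! ### Ends of edges; the sides of triangles and parallelograms -/

namespace TropicalPolynomial

variable {F : TropicalPolynomial} {x y : ℝ × ℝ} {u v w a b : ℤ × ℤ}

/-- If some exponent lies on the left of the line through `u` and `v`, the cell dual to `u` and
`v` ends in this direction. -/
theorem exists_end (hu : u ∈ F.argmax x) (hv : v ∈ F.argmax x)
    (h : ∃ w ∈ F.support, 0 < latticeDet u v w) :
    ∃ y, u ∈ F.argmax y ∧ v ∈ F.argmax y ∧ ∃ w ∈ F.argmax y, 0 < latticeDet u v w := by
  have hne : (F.support.filter (0 < latticeDet u v ·)).Nonempty := by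
    obtain ⟨w, hw, hd⟩ := h
    exact ⟨w, Finset.mem_filter.2 ⟨hw, hd⟩⟩
  -- The quotient is the parameter at which the term `w` catches up with `u`; the cell ends where
  -- the first of these terms does.
  obtain ⟨w, hw, hmin⟩ := Finset.exists_min_image _
    (fun w => (F.term u x - F.term w x) / (latticeDet u v w : ℝ)) hne
  rw [Finset.mem_filter] at hw
  have hwpos : (0 : ℝ) < latticeDet u v w := by exact_mod_cast hw.2
  set r := (F.term u x - F.term w x) / (latticeDet u v w : ℝ) with hr
  have hr0 : 0 ≤ r := div_nonneg (sub_nonneg.2 (hu.2 w hw.1)) hwpos.le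
  have huy : u ∈ F.argmax (x + r • edgeDir u v) := by
    refine ⟨hu.1, fun z hz => sub_nonpos.1 ?_⟩
    rw [term_add_smul_edgeDir]
    have hzx := hu.2 z hz
    by_cases hd : 0 < latticeDet u v z
    · have hdr : (0 : ℝ) < latticeDet u v z := by exact_mod_cast hd
      have := (le_div_iff₀ hdr).1 (hmin z (Finset.mem_filter.2 ⟨hz, hd⟩))
      linarith
    · have hdr : (latticeDet u v z : ℝ) ≤ 0 := by exact_mod_cast not_lt.1 hd
      nlinarith
  refine ⟨_, huy, mem_argmax_of_le huy hv.1 (sub_nonneg.1 ?_), w,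
    mem_argmax_of_le huy hw.1 (sub_nonneg.1 ?_), hw.2⟩
  · rw [term_add_smul_edgeDir, term_eq hv hu]
    simp [latticeDet, mul_comm]
  · rw [term_add_smul_edgeDir, hr, div_mul_cancel₀ _ hwpos.ne']
    simp

/-- At an end some term on the left of `u v` has caught up with `u`, and beyond this point it
exceeds `u`. So neither of the two ends lies beyond the other. -/
theorem end_unique (huv : u ≠ v) {y z : ℝ × ℝ} (hu : u ∈ F.argmax y) (hv : v ∈ F.argmax y)
    (hu' : u ∈ F.argmax z) (hv' : v ∈ F.argmax z)
    (hy : ∃ w ∈ F.argmax y, 0 < latticeDet u v w)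
    (hz : ∃ w ∈ F.argmax z, 0 < latticeDet u v w) : y = z := by
  obtain ⟨r, rfl⟩ := exists_eq_add_smul_edgeDir huv (term_eq hu hv) (term_eq hu' hv')
  obtain ⟨w, hw, hd⟩ := hy
  obtain ⟨w', hw', hd'⟩ := hz
  have h1 := term_add_smul_edgeDir F u v w y r
  have h2 := term_add_smul_edgeDir F u v w' y r
  have e1 := hu'.2 w hw.1
  have e2 := hu.2 w' hw'.1
  have e3 := term_eq hu hw
  have e4 := term_eq hu' hw'
  have hd : (0 : ℝ) < latticeDet u v w := by exact_mod_cast hd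
  have hd' : (0 : ℝ) < latticeDet u v w' := by exact_mod_cast hd'
  have : r = 0 := by
    apply le_antisymm
    · by_contra! h; nlinarith [mul_pos h hd]
    · by_contra! h; nlinarith [mul_neg_of_neg_of_pos h hd']
  simp [this]

/-- At a point dual to the edge itself all terms off the line `u v` are strictly smaller. A term on
the left can catch up only in one direction along the line and a term on the right only in the
other, so they never do so at the same point. -/
theorem not_sides (h : F.IsEdge u v) (hu : u ∈ F.argmax y) (hv : v ∈ F.argmax y)
    (hw : ∃ w ∈ F.argmax y, 0 < latticeDet u v w)
    (hw' : ∃ w ∈ F.argmax y, latticeDet u v w < 0) : False := by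
  obtain ⟨huv, x, hx⟩ := h
  have hux : u ∈ F.argmax x := by rw [hx]; simp
  have hvx : v ∈ F.argmax x := by rw [hx]; simp
  obtain ⟨r, rfl⟩ := exists_eq_add_smul_edgeDir huv (term_eq hux hvx) (term_eq hu hv)
  obtain ⟨w, hw, hd⟩ := hw
  obtain ⟨w', hw', hd'⟩ := hw'
  have h1 := term_add_smul_edgeDir F u v w x r
  have h2 := term_add_smul_edgeDir F u v w' x r
  have hnot : ∀ z ∈ F.support, latticeDet u v z ≠ 0 → F.term z x < F.term u x := by
    intro z hz hd
    refine term_lt hux hz fun hzx => hd ?_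
    rw [hx] at hzx
    rcases hzx with rfl | rfl <;> simp [latticeDet, mul_comm]
  have e1 := hnot w hw.1 hd.ne'
  have e2 := hnot w' hw'.1 hd'.ne
  rw [term_eq hu hw] at h1
  rw [term_eq hu hw'] at h2
  have hd : (0 : ℝ) < latticeDet u v w := by exact_mod_cast hd
  have hd' : (latticeDet u v w' : ℝ) < 0 := by exact_mod_cast hd'
  rcases le_total r 0 with h | h
  · nlinarith [mul_nonpos_of_nonpos_of_nonneg h hd.le]
  · nlinarith [mul_nonpos_of_nonneg_of_nonpos h hd'.le]

theorem IsTriangle.isEdge (h : F.argmax x = {u, v, w}) (hd : |latticeDet u v w| = 1) :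
    F.IsEdge u v ∧ F.IsEdge u w ∧ F.IsEdge v w := by
  obtain ⟨h1, h2, h3⟩ := ne_of_abs_latticeDet_eq_one hd
  have e2 : latticeDet u w v = -latticeDet u v w := latticeDet_swap_right u v w
  have e3 : latticeDet v w u = latticeDet u v w := by simp only [latticeDet]; ring
  have hu : u ∈ F.argmax x := by rw [h]; simp
  have hv : v ∈ F.argmax x := by rw [h]; simp
  have hw : w ∈ F.argmax x := by rw [h]; simp
  refine ⟨isEdge_of_side' hu hv h1 ?_, isEdge_of_side' hu hw h2 ?_, isEdge_of_side' hv hw h3 ?_⟩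
  all_goals
    simp only [h, Set.mem_insert_iff, Set.mem_singleton_iff, forall_eq_or_imp, forall_eq]
    rcases (abs_eq zero_le_one).1 hd with hd | hd <;> simp [*]

theorem IsNode.isEdge (h : F.argmax x = {u, u + a, u + b, u + a + b})
    (hd : |latticeDet u (u + a) (u + b)| = 1) :
    F.IsEdge u (u + a) ∧ F.IsEdge u (u + b) ∧ F.IsEdge (u + b) (u + a + b) ∧
      F.IsEdge (u + a) (u + a + b) := by
  suffices H : ∀ a b : ℤ × ℤ, F.argmax x = {u, u + a, u + b, u + a + b} →
      |latticeDet u (u + a) (u + b)| = 1 →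
      F.IsEdge u (u + a) ∧ F.IsEdge (u + b) (u + a + b) by
    obtain ⟨h', hd'⟩ := IsNode.swap h hd
    have h1 := H a b h hd
    have h2 := H b a h' hd'
    rw [add_right_comm] at h2
    exact ⟨h1.1, h2.1, h1.2, h2.2⟩
  intro a b h hd
  have hne := parallelogram_ne hd
  have hu : u ∈ F.argmax x := by rw [h]; simp
  have hv : u + a ∈ F.argmax x := by rw [h]; simp
  have hw : u + b ∈ F.argmax x := by rw [h]; simp
  have hz : u + a + b ∈ F.argmax x := by rw [h]; simp
  rw [latticeDet_add] at hd
  have e1 : latticeDet u (u + a) (u + b) = a.1 * b.2 - a.2 * b.1 := latticeDet_add u a b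
  have e2 : latticeDet u (u + a) (u + a + b) = a.1 * b.2 - a.2 * b.1 := by
    simp [latticeDet]; ring
  have e3 : latticeDet (u + b) (u + a + b) u = -(a.1 * b.2 - a.2 * b.1) := by
    simp [latticeDet]; ring
  have e4 : latticeDet (u + b) (u + a + b) (u + a) = -(a.1 * b.2 - a.2 * b.1) := by
    simp [latticeDet]; ring
  refine ⟨isEdge_of_side' hu hv (by simp [hne.1]) ?_,
    isEdge_of_side' hw hz (by rw [add_right_comm]; simp [hne.1]) ?_⟩
  all_goals
    simp only [h, Set.mem_insert_iff, Set.mem_singleton_iff, forall_eq_or_imp, forall_eq,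
      e1, e2, e3, e4]
    rcases (abs_eq zero_le_one).1 hd with hd | hd <;> rw [hd] <;> simp

/-- The diagonals of a parallelogram are not edges. -/
theorem IsNode.eq_or_eq (h : F.argmax x = {u, u + a, u + b, u + a + b})
    (hd : |latticeDet u (u + a) (u + b)| = 1) (he : F.IsEdge u v) (hv : v ∈ F.argmax x) :
    v = u + a ∨ v = u + b := by
  have hu : u ∈ F.argmax x := by rw [h]; simp
  rw [h] at hv
  rcases hv with rfl | hv | hv | hv
  · exact absurd rfl he.1
  · exact Or.inl hv
  · exact Or.inr hv
  · exfalso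
    have e1 : latticeDet u (u + a + b) (u + b) = latticeDet u (u + a) (u + b) := by
      simp [latticeDet]; ring
    have e2 : latticeDet u (u + a + b) (u + a) = -latticeDet u (u + a) (u + b) := by
      simp [latticeDet]; ring
    have ha : u + a ∈ F.argmax x := by rw [h]; simp
    have hb : u + b ∈ F.argmax x := by rw [h]; simp
    have hv' : v ∈ F.argmax x := by rw [h]; simp [hv]
    rcases (abs_eq zero_le_one).1 hd with hd | hd
    · exact not_sides he hu hv' ⟨_, hb, by rw [hv, e1, hd]; simp⟩
        ⟨_, ha, by rw [hv, e2, hd]; simp⟩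
    · exact not_sides he hu hv' ⟨_, ha, by rw [hv, e2, hd]; simp⟩
        ⟨_, hb, by rw [hv, e1, hd]; simp⟩

theorem IsTriangle.not_isCollinear (h : F.IsTriangle x) : ¬ IsCollinear (F.argmax x) := by
  obtain ⟨u, v, w, hx, hd⟩ := h
  intro hc
  rw [hc u (by rw [hx]; simp) v (by rw [hx]; simp) w (by rw [hx]; simp)] at hd
  simp at hd

theorem IsNode.not_isCollinear (h : F.IsNode x) : ¬ IsCollinear (F.argmax x) := by
  obtain ⟨u, a, b, hx, hd⟩ := h
  intro hc
  rw [hc u (by rw [hx]; simp) (u + a) (by rw [hx]; simp) (u + b) (by rw [hx]; simp)] at hd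
  simp at hd

theorem IsNode.not_isTriangle (h : F.IsNode x) : ¬ F.IsTriangle x := by
  obtain ⟨u, a, b, hx, hd⟩ := h
  intro ht
  obtain ⟨v, w, hx', -⟩ := ht.corner (u := u) (by rw [hx]; simp)
  obtain ⟨ha, hb, hab, hab'⟩ := parallelogram_ne hd
  have hcard : ({u, u + a, u + b, u + a + b} : Set (ℤ × ℤ)).ncard = 4 := by
    rw [Set.ncard_eq_toFinset_card']
    have h1 : u ≠ u + a + b := by rw [add_assoc]; simpa using hab'
    have h2 : u + b ≠ u + a + b := by rw [add_right_comm]; simpa using ha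
    simp [*]
  rw [← hx, hx'] at hcard
  have := Set.ncard_insert_le u {v, w}
  have := Set.ncard_insert_le v {w}
  have := Set.ncard_singleton w
  omega

end TropicalPolynomial

/-! ### Consequences of nodality: one-dimensional cells and their ends -/

namespace NodalTropicalCurve

open TropicalPolynomial

variable {Γ : NodalTropicalCurve} {x y : ℝ × ℝ} {u v w a b : ℤ × ℤ}

theorem exists_latticeDet_ne_zero (Γ : NodalTropicalCurve) (huv : u ≠ v) :
    ∃ w ∈ Γ.support, latticeDet u v w ≠ 0 := by
  by_contra! h
  exact Γ.newton_twoDimensional (isCollinear_of_latticeDet_eq_zero huv h)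

/-- No three corners of a triangle or of a parallelogram are collinear. -/
theorem latticeDet_ne_zero (hx : ¬ IsCollinear (Γ.argmax x)) (hu : u ∈ Γ.argmax x)
    (hv : v ∈ Γ.argmax x) (hw : w ∈ Γ.argmax x) (huv : u ≠ v) (huw : u ≠ w) (hvw : v ≠ w) :
    latticeDet u v w ≠ 0 := by
  rcases Γ.nodal x hx with h | h
  · obtain ⟨v', w', h, hd⟩ := h.corner hu
    have hd0 : latticeDet u v' w' ≠ 0 := by intro h0; simp [h0] at hd
    rw [h] at hv hw
    rcases hv with rfl | rfl | rfl
    · exact absurd rfl huv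
    · rcases hw with rfl | rfl | rfl
      · exact absurd rfl huw
      · exact absurd rfl hvw
      · exact hd0
    · rcases hw with rfl | rfl | rfl
      · exact absurd rfl huw
      · rwa [latticeDet_swap_right, neg_ne_zero]
      · exact absurd rfl hvw
  · obtain ⟨a, b, h, hd⟩ := h.corner hu
    have hd0 : latticeDet u (u + a) (u + b) ≠ 0 := by intro h0; simp [h0] at hd
    rw [latticeDet_add] at hd0
    rw [h] at hv hw
    rcases hv with rfl | rfl | rfl | rfl
    · exact absurd rfl huv
    all_goals
      rcases hw with rfl | rfl | rfl | rfl
      · exact absurd rfl huw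
    all_goals first
      | exact absurd rfl hvw
      | (intro h0; apply hd0; simp [latticeDet] at h0 ⊢; linarith)

/-- The one-dimensional cells of the subdivision have no lattice points besides their ends. -/
theorem argmax_eq_pair (hx : IsCollinear (Γ.argmax x)) (hu : u ∈ Γ.argmax x)
    (hv : v ∈ Γ.argmax x) (huv : u ≠ v) : Γ.argmax x = {u, v} := by
  wlog H : ∃ w ∈ Γ.support, 0 < latticeDet u v w generalizing u v
  · rw [Set.pair_comm]
    refine this hv hu huv.symm ?_
    obtain ⟨w, hw, hd⟩ := Γ.exists_latticeDet_ne_zero huv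
    refine ⟨w, hw, ?_⟩
    push Not at H
    rw [latticeDet_swap]
    have := H w hw
    omega
  -- A third exponent on the line `u v` would remain maximal up to the end `y`, and the
  -- two-dimensional cell dual to `y` would have three collinear corners.
  obtain ⟨y, hu', hv', w, hw, hd⟩ := exists_end hu hv H
  have hy : ¬ IsCollinear (Γ.argmax y) := fun h => hd.ne' (h u hu' v hv' w hw)
  refine Set.Subset.antisymm (fun z hz => ?_) (Set.insert_subset hu (by simpa using hv))
  by_contra hne
  simp only [Set.mem_insert_iff, Set.mem_singleton_iff, not_or] at hne
  have hd0 : latticeDet u v z = 0 := hx u hu v hv z hz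
  refine latticeDet_ne_zero hy hu' hv' (w := z) ?_ huv (Ne.symm hne.1) (Ne.symm hne.2) hd0
  obtain ⟨r, rfl⟩ := exists_eq_add_smul_edgeDir huv (term_eq hu hv) (term_eq hu' hv')
  refine mem_argmax_of_le hu' hz.1 (sub_nonneg.1 ?_)
  rw [term_add_smul_edgeDir, hd0, term_eq hz hu]
  simp

/-- A bounded edge of the curve has exactly two ends. -/
theorem ends_eq_pair (h : Γ.IsEdge u v) (h₁ : ∃ w ∈ Γ.support, 0 < latticeDet u v w)
    (h₂ : ∃ w ∈ Γ.support, latticeDet u v w < 0) :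
    ∃ y z, y ≠ z ∧
      {x | ¬ IsCollinear (Γ.argmax x) ∧ u ∈ Γ.argmax x ∧ v ∈ Γ.argmax x} = {y, z} := by
  obtain ⟨huv, x, hx⟩ := id h
  have hu : u ∈ Γ.argmax x := by rw [hx]; simp
  have hv : v ∈ Γ.argmax x := by rw [hx]; simp
  have hneg : ∀ w, 0 < latticeDet v u w ↔ latticeDet u v w < 0 := by
    intro w; rw [latticeDet_swap]; omega
  obtain ⟨y, huy, hvy, hy⟩ := exists_end hu hv h₁
  obtain ⟨z, hvz, huz, hz⟩ := exists_end hv hu (by simpa only [hneg] using h₂)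
  refine ⟨y, z, ?_, Set.Subset.antisymm ?_ ?_⟩
  · rintro rfl
    exact not_sides h huy hvy hy (by simpa only [hneg] using hz)
  · rintro t ⟨ht, hut, hvt⟩
    obtain ⟨w, hw, hd⟩ : ∃ w ∈ Γ.argmax t, latticeDet u v w ≠ 0 := by
      by_contra! h0
      exact ht (isCollinear_of_latticeDet_eq_zero huv h0)
    rcases hd.lt_or_gt with hd | hd
    · exact Or.inr (end_unique huv.symm hvt hut hvz huz ⟨w, hw, (hneg w).2 hd⟩ hz)
    · exact Or.inl (end_unique huv hut hvt huy hvy ⟨w, hw, hd⟩ hy)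
  · rintro t (rfl | rfl)
    · obtain ⟨w, hw, hd⟩ := hy
      exact ⟨fun hc => hd.ne' (hc u huy v hvy w hw), huy, hvy⟩
    · obtain ⟨w, hw, hd⟩ := hz
      exact ⟨fun hc => hd.ne' (hc v hvz u huz w hw), huz, hvz⟩

end NodalTropicalCurve

/-! ### Potentials of cocycles on the dual subdivision -/

/-- A linear form with irrational slope, by which lattice points are ordered. -/
noncomputable def irrationalHeight (u : ℤ × ℤ) : ℝ := u.1 + u.2 * √2

theorem irrationalHeight_injective : Function.Injective irrationalHeight := by
  intro u v h
  simp only [irrationalHeight] at h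
  have h2 : u.2 = v.2 := by
    by_contra hne
    have hne' : ((u.2 - v.2 : ℤ) : ℝ) ≠ 0 := by exact_mod_cast sub_ne_zero.2 hne
    refine irrational_sqrt_two ⟨(v.1 - u.1 : ℤ) / (u.2 - v.2 : ℤ), ?_⟩
    push_cast at hne' ⊢
    rw [div_eq_iff hne']
    linarith
  refine Prod.ext ?_ h2
  rw [h2] at h
  exact_mod_cast add_right_cancel h

namespace TropicalPolynomial

variable {F : TropicalPolynomial} {x y : ℝ × ℝ} {u v w a b : ℤ × ℤ}

theorem term_add_smul_sqrt_two (F : TropicalPolynomial) (u : ℤ × ℤ) (x : ℝ × ℝ) (s : ℝ) :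
    F.term u (x + s • ((1, √2) : ℝ × ℝ)) = F.term u x + s * irrationalHeight u := by
  simp only [term, irrationalHeight, Prod.fst_add, Prod.snd_add, Prod.smul_fst, Prod.smul_snd,
    smul_eq_mul]
  ring

theorem term_combination (F : TropicalPolynomial) (u : ℤ × ℤ) (x y : ℝ × ℝ) {r s : ℝ}
    (h : r + s = 1) : F.term u (r • x + s • y) = r * F.term u x + s * F.term u y := by
  simp only [term, Prod.fst_add, Prod.snd_add, Prod.smul_fst, Prod.smul_snd, smul_eq_mul]
  linear_combination (-F.coeff u) * h

/-- The region of the plane in which a given term is maximal is convex. -/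
theorem convex_region (F : TropicalPolynomial) (u : ℤ × ℤ) : Convex ℝ {x | u ∈ F.argmax x} := by
  intro x hx y hy r s hr hs hrs
  refine ⟨hx.1, fun v hv => ?_⟩
  rw [term_combination F u x y hrs, term_combination F v x y hrs]
  have h1 := mul_le_mul_of_nonneg_left (hx.2 v hv) hr
  have h2 := mul_le_mul_of_nonneg_left (hy.2 v hv) hs
  linarith

/-- The part of the boundary of a region in which one leaves it when moving in the direction
`(1, √2)` is connected. -/
theorem isPreconnected_upperBoundary (F : TropicalPolynomial) (u : ℤ × ℤ) :
    IsPreconnected {x | u ∈ F.argmax x ∧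
      ∃ v ∈ F.argmax x, irrationalHeight u < irrationalHeight v} := by
  by_cases hne : (F.support.filter (irrationalHeight u < irrationalHeight ·)).Nonempty
  swap
  · convert isPreconnected_empty
    rw [Set.eq_empty_iff_forall_notMem]
    rintro x ⟨-, v, hv, huv⟩
    exact hne ⟨v, Finset.mem_filter.2 ⟨hv.1, huv⟩⟩
  -- `D x` is the distance, in multiples of `(1, √2)`, after which a point of the region leaves it
  -- in this direction.
  set D : ℝ × ℝ → ℝ := fun x => (F.support.filter
    (irrationalHeight u < irrationalHeight ·)).inf' hne fun v =>
      (F.term u x - F.term v x) / (irrationalHeight v - irrationalHeight u) with hD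
  have hcont : Continuous D := by
    refine Continuous.finset_inf'_apply hne fun v _ => ?_
    exact ((F.continuous_term u).sub (F.continuous_term v)).div_const _
  have hD0 : ∀ x, u ∈ F.argmax x → 0 ≤ D x := by
    intro x hx
    refine Finset.le_inf' _ _ fun v hv => ?_
    rw [Finset.mem_filter] at hv
    exact div_nonneg (sub_nonneg.2 (hx.2 v hv.1)) (sub_nonneg.2 hv.2.le)
  -- Pushing every point up to the boundary retracts the convex region onto its upper boundary,
  -- which is thus a continuous image of a connected set.
  convert (F.convex_region u).isPreconnected.image (fun x => x + D x • ((1, √2) : ℝ × ℝ))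
    (by fun_prop) using 1
  refine Set.Subset.antisymm ?_ ?_
  · rintro x ⟨hx, v, hv, huv⟩
    refine ⟨x, hx, ?_⟩
    have : D x ≤ 0 := by
      refine (Finset.inf'_le _ (Finset.mem_filter.2 ⟨hv.1, huv⟩)).trans ?_
      rw [term_eq hx hv]; simp
    simp [le_antisymm this (hD0 x hx)]
  · rintro _ ⟨x, hx, rfl⟩
    have hx : u ∈ F.argmax x := hx
    obtain ⟨w, hw, hDw⟩ := Finset.exists_mem_eq_inf' hne fun v =>
      (F.term u x - F.term v x) / (irrationalHeight v - irrationalHeight u)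
    have hDw : D x = (F.term u x - F.term w x) / (irrationalHeight w - irrationalHeight u) := hDw
    rw [Finset.mem_filter] at hw
    have hu' : u ∈ F.argmax (x + D x • ((1, √2) : ℝ × ℝ)) := by
      refine ⟨hx.1, fun v hv => ?_⟩
      rw [term_add_smul_sqrt_two, term_add_smul_sqrt_two]
      have h1 := hx.2 v hv
      by_cases huv : irrationalHeight u < irrationalHeight v
      · have : D x ≤ _ := Finset.inf'_le _ (Finset.mem_filter.2 ⟨hv, huv⟩)
        rw [le_div_iff₀ (sub_pos.2 huv)] at this
        linarith
      · nlinarith [hD0 x hx]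
    refine ⟨hu', w, mem_argmax_of_le hu' hw.1 ?_, hw.2⟩
    rw [term_add_smul_sqrt_two, term_add_smul_sqrt_two, hDw]
    have h2 : irrationalHeight w - irrationalHeight u ≠ 0 := (sub_pos.2 hw.2).ne'
    apply le_of_eq
    field_simp
    ring

end TropicalPolynomial

namespace NodalTropicalCurve

open TropicalPolynomial

variable {Γ : NodalTropicalCurve} {x y : ℝ × ℝ} {u v w a b : ℤ × ℤ}

/-- A closed `1`-cochain modulo `2` on the dual subdivision of a nodal curve which has equal
values at opposite sides of the parallelograms. -/
structure IsCocycle (Γ : NodalTropicalCurve) (α : Set (ℤ × ℤ) → ZMod 2) : Prop where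
  triangle : ∀ {x u v w}, Γ.argmax x = {u, v, w} → |latticeDet u v w| = 1 →
    α {u, v} + α {u, w} + α {v, w} = 0
  node : ∀ {x u a b}, Γ.argmax x = {u, u + a, u + b, u + a + b} →
    |latticeDet u (u + a) (u + b)| = 1 → α {u, u + a} = α {u + b, u + a + b}

/-- The local comparison, for upward edges that meet at one point. In a triangle it is closedness,
as the third side already lies above `u`. In a parallelogram the two paths from `u` to the opposite
corner have equal sums, as opposite sides have equal values; this corner also lies above `u`. -/
theorem IsCocycle.consistent {α : Set (ℤ × ℤ) → ZMod 2} (hα : Γ.IsCocycle α)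
    {c : ℤ × ℤ → ZMod 2}
    (hc : ∀ v w, irrationalHeight u < irrationalHeight v → irrationalHeight u < irrationalHeight w →
      Γ.IsEdge v w → c v + c w = α {v, w})
    (hu : u ∈ Γ.argmax x) (hv : v ∈ Γ.argmax x) (hw : w ∈ Γ.argmax x)
    (huv : Γ.IsEdge u v) (huw : Γ.IsEdge u w)
    (hv' : irrationalHeight u < irrationalHeight v)
    (hw' : irrationalHeight u < irrationalHeight w) :
    c v + α {u, v} = c w + α {u, w} := by
  have two : ∀ z : ZMod 2, z + z = 0 := by decide
  by_cases hvw : v = w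
  · rw [hvw]
  by_cases hx : IsCollinear (Γ.argmax x)
  · have := argmax_eq_pair hx hu hv huv.1
    rw [this] at hw
    rcases hw with rfl | rfl
    · exact absurd rfl huw.1
    · exact absurd rfl hvw
  rcases Γ.nodal x hx with ht | hn
  · obtain ⟨v₁, w₁, h, hd⟩ := ht.corner hu
    have e : ∀ v w, Γ.argmax x = {u, v, w} → |latticeDet u v w| = 1 →
        irrationalHeight u < irrationalHeight v → irrationalHeight u < irrationalHeight w →
        c v + α {u, v} = c w + α {u, w} := by
      intro v w h hd hv' hw'
      have e1 := hα.triangle h hd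
      rw [← hc v w hv' hw' (IsTriangle.isEdge h hd).2.2] at e1
      linear_combination e1 - two (c w) - two (α {u, w})
    rw [h] at hv hw
    rcases hv with rfl | rfl | rfl
    · exact absurd rfl huv.1
    · rcases hw with rfl | rfl | rfl
      · exact absurd rfl huw.1
      · exact absurd rfl hvw
      · exact e _ _ h hd hv' hw'
    · rcases hw with rfl | rfl | rfl
      · exact absurd rfl huw.1
      · exact (e _ _ h hd hw' hv').symm
      · exact absurd rfl hvw
  · obtain ⟨a, b, h, hd⟩ := hn.corner hu
    have e : irrationalHeight u < irrationalHeight (u + a) →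
        irrationalHeight u < irrationalHeight (u + b) →
        c (u + a) + α {u, u + a} = c (u + b) + α {u, u + b} := by
      intro ha hb
      have hab : irrationalHeight u < irrationalHeight (u + a + b) := by
        simp only [irrationalHeight, Prod.fst_add, Prod.snd_add] at ha hb ⊢
        push_cast at ha hb ⊢
        linarith
      obtain ⟨-, -, h3, h4⟩ := IsNode.isEdge h hd
      obtain ⟨h', hd'⟩ := IsNode.swap h hd
      rw [hα.node h hd, hα.node h' hd', add_right_comm u b a, ← hc _ _ hb hab h3,
        ← hc _ _ ha hab h4]
      ring
    rcases IsNode.eq_or_eq h hd huv hv with rfl | rfl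
    · rcases IsNode.eq_or_eq h hd huw hw with rfl | rfl
      · exact absurd rfl hvw
      · exact e hv' hw'
    · rcases IsNode.eq_or_eq h hd huw hw with rfl | rfl
      · exact (e hw' hv').symm
      · exact absurd rfl hvw

/-- A higher corner of a parallelogram may be the one opposite to `u`, which is not joined to `u` by
an edge. By additivity of the height one of the two neighbours of `u` is then higher too. -/
theorem exists_isEdge_up (hu : u ∈ Γ.argmax x)
    (h : ∃ v ∈ Γ.argmax x, irrationalHeight u < irrationalHeight v) :
    ∃ v ∈ Γ.argmax x, irrationalHeight u < irrationalHeight v ∧ Γ.IsEdge u v := by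
  obtain ⟨v, hv, hlt⟩ := h
  have huv : u ≠ v := by rintro rfl; exact lt_irrefl _ hlt
  by_cases hx : IsCollinear (Γ.argmax x)
  · exact ⟨v, hv, hlt, huv, x, argmax_eq_pair hx hu hv huv⟩
  rcases Γ.nodal x hx with ht | hn
  · obtain ⟨v₁, w₁, h, hd⟩ := ht.corner hu
    obtain ⟨h1, h2, -⟩ := IsTriangle.isEdge h hd
    refine ⟨v, hv, hlt, ?_⟩
    rw [h] at hv
    rcases hv with rfl | rfl | rfl
    · exact absurd rfl huv
    · exact h1
    · exact h2
  · obtain ⟨a, b, h, hd⟩ := hn.corner hu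
    obtain ⟨h1, h2, -⟩ := IsNode.isEdge h hd
    have ha : u + a ∈ Γ.argmax x := by rw [h]; simp
    have hb : u + b ∈ Γ.argmax x := by rw [h]; simp
    by_cases hla : irrationalHeight u < irrationalHeight (u + a)
    · exact ⟨_, ha, hla, h1⟩
    by_cases hlb : irrationalHeight u < irrationalHeight (u + b)
    · exact ⟨_, hb, hlb, h2⟩
    exfalso
    rw [h] at hv
    rcases hv with rfl | rfl | rfl | rfl
    · exact huv rfl
    · exact hla hlt
    · exact hlb hlt
    · simp only [irrationalHeight, Prod.fst_add, Prod.snd_add] at hla hlb hlt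
      push_cast at hla hlb hlt
      linarith

/-- All upward edges from `u` give the same value to the potential at `u`. -/
theorem IsCocycle.consistent_up {α : Set (ℤ × ℤ) → ZMod 2} (hα : Γ.IsCocycle α)
    {c : ℤ × ℤ → ZMod 2}
    (hc : ∀ v w, irrationalHeight u < irrationalHeight v → irrationalHeight u < irrationalHeight w →
      Γ.IsEdge v w → c v + c w = α {v, w})
    (huv : Γ.IsEdge u v) (huw : Γ.IsEdge u w)
    (hv' : irrationalHeight u < irrationalHeight v)
    (hw' : irrationalHeight u < irrationalHeight w) :
    c v + α {u, v} = c w + α {u, w} := by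
  obtain ⟨-, x, hx⟩ := id huv
  obtain ⟨-, y, hy⟩ := id huw
  have hxu : u ∈ Γ.argmax x := by rw [hx]; simp
  have hxv : v ∈ Γ.argmax x := by rw [hx]; simp
  have hyu : u ∈ Γ.argmax y := by rw [hy]; simp
  have hyw : w ∈ Γ.argmax y := by rw [hy]; simp
  refine IsPreconnected.induction₂ (Γ.isPreconnected_upperBoundary u)
    (fun x y => ∀ v ∈ Γ.argmax x, ∀ w ∈ Γ.argmax y,
      irrationalHeight u < irrationalHeight v → irrationalHeight u < irrationalHeight w →
      Γ.IsEdge u v → Γ.IsEdge u w → c v + α {u, v} = c w + α {u, w}) ?_ ?_ ?_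
    (x := x) (y := y) ⟨hxu, v, hxv, hv'⟩ ⟨hyu, w, hyw, hw'⟩ v hxv w hyw hv' hw' huv huw
  · rintro x ⟨hx, -⟩
    filter_upwards [nhdsWithin_le_nhds (Γ.eventually_argmax_subset x)] with y hy
    intro v hv w hw hv' hw' huv huw
    exact hα.consistent hc hx hv (hy hw) huv huw hv' hw'
  · rintro x y z - ⟨hy, hy'⟩ - hxy hyz v hv w hw hv' hw' huv huw
    obtain ⟨t, ht, ht', hut⟩ := exists_isEdge_up hy hy'
    exact (hxy v hv t ht hv' ht' huv hut).trans (hyz t ht w hw ht' hw' hut huw)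
  · rintro x y - - hxy v hv w hw hv' hw' huv huw
    exact (hxy w hw v hv hw' hv' huw huv).symm

/-- Induction over the sets of exponents that are closed upwards in height. The new exponent is the
lowest one, so all its edges into the set point upwards, and `consistent_up` says that they
prescribe a single value. -/
theorem IsCocycle.exists_potential {α : Set (ℤ × ℤ) → ZMod 2} (hα : Γ.IsCocycle α) :
    ∃ c : ℤ × ℤ → ZMod 2, ∀ u v, Γ.IsEdge u v → c u + c v = α {u, v} := by
  classical
  suffices H : ∀ s : Finset (ℤ × ℤ), s ⊆ Γ.support →
      (∀ u ∈ s, ∀ v ∈ Γ.support, irrationalHeight u < irrationalHeight v → v ∈ s) →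
      ∃ c : ℤ × ℤ → ZMod 2, ∀ u ∈ s, ∀ v ∈ s, Γ.IsEdge u v → c u + c v = α {u, v} by
    obtain ⟨c, hc⟩ := H Γ.support subset_rfl fun _ _ v hv _ => hv
    refine ⟨c, fun u v huv => ?_⟩
    obtain ⟨-, x, hx⟩ := id huv
    exact hc u (Γ.argmax_subset x (by rw [hx]; simp)) v (Γ.argmax_subset x (by rw [hx]; simp)) huv
  intro s
  induction s using Finset.induction_on_min_value irrationalHeight with
  | empty => simp
  | insert u s hus hmin ih =>
    intro hsub hup
    have hlt : ∀ v ∈ s, irrationalHeight u < irrationalHeight v := fun v hv =>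
      lt_of_le_of_ne (hmin v hv) fun h => hus (irrationalHeight_injective h ▸ hv)
    obtain ⟨c, hc⟩ := ih (fun v hv => hsub (Finset.mem_insert_of_mem hv)) (by
      intro v hv w hw hvw
      rcases Finset.mem_insert.1 (hup v (Finset.mem_insert_of_mem hv) w hw hvw) with rfl | h
      · exact absurd (hlt v hv) hvw.not_gt
      · exact h)
    have hs : ∀ v ∈ Γ.support, irrationalHeight u < irrationalHeight v → v ∈ s := by
      intro v hv huv
      rcases Finset.mem_insert.1 (hup u (Finset.mem_insert_self u s) v hv huv) with rfl | h
      · exact absurd huv (lt_irrefl _)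
      · exact h
    have hsupp : ∀ {v w}, Γ.IsEdge v w → v ∈ Γ.support ∧ w ∈ Γ.support := by
      rintro v w ⟨-, x, hx⟩
      exact ⟨Γ.argmax_subset x (by rw [hx]; simp), Γ.argmax_subset x (by rw [hx]; simp)⟩
    have hc' : ∀ v w, irrationalHeight u < irrationalHeight v →
        irrationalHeight u < irrationalHeight w → Γ.IsEdge v w → c v + c w = α {v, w} :=
      fun v w hv hw h => hc v (hs v (hsupp h).1 hv) w (hs w (hsupp h).2 hw) h
    -- Without an upward edge nothing is prescribed, and the value `0` is arbitrary.
    obtain ⟨k, hk⟩ : ∃ k : ZMod 2, ∀ v ∈ s, Γ.IsEdge u v → k + c v = α {u, v} := by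
      have two : ∀ z : ZMod 2, z + z = 0 := by decide
      by_cases hex : ∃ v ∈ s, Γ.IsEdge u v
      · obtain ⟨v, hv, huv⟩ := hex
        refine ⟨c v + α {u, v}, fun w hw huw => ?_⟩
        rw [hα.consistent_up hc' huv huw (hlt v hv) (hlt w hw)]
        linear_combination two (c w)
      · exact ⟨0, fun v hv huv => absurd ⟨v, hv, huv⟩ hex⟩
    refine ⟨Function.update c u k, fun v hv₀ w hw₀ hvw => ?_⟩
    rcases Finset.mem_insert.1 hv₀ with rfl | hv
    · rcases Finset.mem_insert.1 hw₀ with rfl | hw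
      · exact absurd rfl hvw.1
      · rw [Function.update_self, Function.update_of_ne (by rintro rfl; exact hus hw)]
        exact hk w hw hvw
    · rcases Finset.mem_insert.1 hw₀ with rfl | hw
      · rw [Function.update_self, Function.update_of_ne (by rintro rfl; exact hus hv), add_comm,
          Set.pair_comm]
        exact hk v hv hvw.symm
      · rw [Function.update_of_ne (by rintro rfl; exact hus hv),
          Function.update_of_ne (by rintro rfl; exact hus hw)]
        exact hc v hv w hw hvw

end NodalTropicalCurve

/-! ### Strands lie on lines; the cells of the skeleton are bounded -/

namespace TropicalPolynomial

variable {F : TropicalPolynomial} {x y : ℝ × ℝ} {u v w a b : ℤ × ℤ}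

/-- A coordinate along the line on which the terms `u` and `u + a` agree. -/
def edgePos (a : ℤ × ℤ) (x : ℝ × ℝ) : ℝ := a.1 * x.2 - a.2 * x.1

theorem edgeDir_add (u a : ℤ × ℤ) : edgeDir u (u + a) = (-(a.2 : ℝ), (a.1 : ℝ)) := by
  ext <;> simp [edgeDir]

theorem edgePos_add_smul (u a : ℤ × ℤ) (x : ℝ × ℝ) (r : ℝ) :
    edgePos a (x + r • edgeDir u (u + a)) =
      edgePos a x + r * ((a.1 : ℝ) ^ 2 + (a.2 : ℝ) ^ 2) := by
  rw [edgeDir_add]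
  simp only [edgePos, Prod.fst_add, Prod.snd_add, Prod.smul_fst, Prod.smul_snd, smul_eq_mul]
  ring

theorem sq_add_sq_pos_of_ne_zero (ha : a ≠ 0) : 0 < (a.1 : ℝ) ^ 2 + (a.2 : ℝ) ^ 2 := by
  have : a.1 ≠ 0 ∨ a.2 ≠ 0 := by
    by_contra! h
    exact ha (Prod.ext h.1 h.2)
  rcases this with h | h
  · have : (a.1 : ℝ) ≠ 0 := by exact_mod_cast h
    positivity
  · have : (a.2 : ℝ) ≠ 0 := by exact_mod_cast h
    positivity

/-- On the line on which two terms agree, a point is determined by its position. -/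
theorem eq_of_edgePos_eq (ha : a ≠ 0) (hx : F.term u x = F.term (u + a) x)
    (hy : F.term u y = F.term (u + a) y) (h : edgePos a x = edgePos a y) : x = y := by
  obtain ⟨r, rfl⟩ := exists_eq_add_smul_edgeDir (by simpa using ha) hx hy
  rw [edgePos_add_smul] at h
  have : r = 0 := by
    have := sq_add_sq_pos_of_ne_zero ha
    have h0 : r * ((a.1 : ℝ) ^ 2 + (a.2 : ℝ) ^ 2) = 0 := by linarith
    exact (mul_eq_zero.1 h0).resolve_right this.ne'
  simp [this]

/-- The points in the interior of an edge of the curve are dual to collinear sets. -/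
theorem isCollinear_of_between {y z : ℝ × ℝ} (ha : a ≠ 0) (hu : u ∈ F.argmax y)
    (hv : u + a ∈ F.argmax y) (hu' : u ∈ F.argmax z) (hv' : u + a ∈ F.argmax z)
    (hx : F.term u x = F.term (u + a) x) (h : edgePos a y < edgePos a x)
    (h' : edgePos a x < edgePos a z) : IsCollinear (F.argmax x) := by
  have hne : u ≠ u + a := by simpa using ha
  have hpos := sq_add_sq_pos_of_ne_zero ha
  obtain ⟨r, hr⟩ := exists_eq_add_smul_edgeDir hne hx (term_eq hu hv)
  obtain ⟨s, hs⟩ := exists_eq_add_smul_edgeDir hne hx (term_eq hu' hv')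
  have hr0 : r < 0 := by
    rw [hr, edgePos_add_smul] at h
    by_contra! h0
    nlinarith [mul_nonneg h0 hpos.le]
  have hs0 : 0 < s := by
    rw [hs, edgePos_add_smul] at h'
    by_contra! h0
    nlinarith [mul_nonneg (neg_nonneg.2 h0) hpos.le]
  have key : ∀ w ∈ F.support, F.term w x - F.term u x + r * latticeDet u (u + a) w ≤ 0 ∧
      F.term w x - F.term u x + s * latticeDet u (u + a) w ≤ 0 := by
    intro w hw
    rw [← term_add_smul_edgeDir, ← term_add_smul_edgeDir, ← hr, ← hs]
    exact ⟨sub_nonpos.2 (hu.2 w hw), sub_nonpos.2 (hu'.2 w hw)⟩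
  refine isCollinear_of_latticeDet_eq_zero hne fun w hw => ?_
  have hux := hw.2 u hu.1
  obtain ⟨h1, h2⟩ := key w hw.1
  by_contra hd
  rcases lt_or_gt_of_ne hd with hd | hd
  · have hd : (latticeDet u (u + a) w : ℝ) < 0 := by exact_mod_cast hd
    nlinarith [mul_pos_of_neg_of_neg hr0 hd]
  · have hd : (0 : ℝ) < latticeDet u (u + a) w := by exact_mod_cast hd
    nlinarith [mul_pos hs0 hd]

end TropicalPolynomial

namespace NodalTropicalCurve

open TropicalPolynomial

variable {Γ : NodalTropicalCurve} {x y : ℝ × ℝ} {u v w a b : ℤ × ℤ}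

theorem Cell.exists_pair (s : Γ.Cell) : ∃ u v, s.1 = {u, v} ∧ Γ.IsEdge u v := by
  obtain ⟨s, ⟨x, rfl⟩, ⟨u, hu, v, hv, huv⟩, hcol⟩ := s
  exact ⟨u, v, argmax_eq_pair hcol hu hv huv, huv, x, argmax_eq_pair hcol hu hv huv⟩

/-- The cell dual to an edge of the subdivision. -/
def cellOfEdge (h : Γ.IsEdge u v) : Γ.Cell :=
  ⟨{u, v}, h.2, Set.nontrivial_pair h.1, by
    refine isCollinear_of_latticeDet_eq_zero h.1 fun w hw => ?_
    rcases hw with rfl | rfl <;> simp [latticeDet, mul_comm]⟩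

theorem Cell.isEdge {s : Γ.Cell} (h : s.1 = {u, v}) : Γ.IsEdge u v := by
  refine ⟨?_, ?_⟩
  · rintro rfl
    have := s.2.2.1
    rw [h] at this
    simp at this
  · rw [← h]; exact s.2.1

instance : Finite Γ.Cell := by
  have : {s : Set (ℤ × ℤ) | s ⊆ Γ.support}.Finite := Γ.support.finite_toSet.finite_subsets
  refine (this.subset
    (t := {s | (∃ x, Γ.argmax x = s) ∧ s.Nontrivial ∧ IsCollinear s}) ?_).to_subtype
  rintro _ ⟨⟨x, rfl⟩, -⟩
  exact Γ.argmax_subset x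

/-- Three maximal terms with affinely independent exponents agree at only one point. This gives the
finiteness of the set of triangles and nodes. -/
theorem eq_of_argmax_eq (hx : ¬ IsCollinear (Γ.argmax x)) (h : Γ.argmax x = Γ.argmax y) :
    x = y := by
  simp only [IsCollinear, not_forall] at hx
  obtain ⟨u, hu, v, hv, w, hw, hd⟩ := hx
  have huv : u ≠ v := by rintro rfl; simp [latticeDet] at hd
  obtain ⟨r, rfl⟩ := exists_eq_add_smul_edgeDir huv (term_eq hu hv) (term_eq (h ▸ hu) (h ▸ hv))
  have := term_add_smul_edgeDir Γ.toTropicalPolynomial u v w x r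
  rw [h] at hw
  have e2 := term_eq (h ▸ hu) hw
  rw [← h] at hw
  have e1 := term_eq hu hw
  have hd : (latticeDet u v w : ℝ) ≠ 0 := by exact_mod_cast hd
  have hr : r * latticeDet u v w = 0 := by linarith
  simp [(mul_eq_zero.1 hr).resolve_right hd]

theorem finite_noncollinear (Γ : NodalTropicalCurve) :
    {x | ¬ IsCollinear (Γ.argmax x)}.Finite := by
  refine Set.Finite.of_finite_image (f := Γ.argmax) ?_ fun x hx y _ h => eq_of_argmax_eq hx h
  refine (Γ.support.finite_toSet.finite_subsets).subset ?_
  rintro _ ⟨x, -, rfl⟩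
  exact Γ.argmax_subset x

theorem ContinueThroughNode.symm {s t : Γ.Cell} (h : Γ.ContinueThroughNode s t) :
    Γ.ContinueThroughNode t s := by
  obtain ⟨p, hp, hs, ht, hd⟩ := h
  exact ⟨p, hp, ht, hs, hd.symm⟩

theorem ContinueThroughNode.exists_parallelogram {s t : Γ.Cell} (h : Γ.ContinueThroughNode s t)
    (hs : s.1 = {u, u + a}) : ∃ p b, Γ.argmax p = {u, u + a, u + b, u + a + b} ∧
      |latticeDet u (u + a) (u + b)| = 1 ∧ t.1 = {u + b, u + a + b} := by
  obtain ⟨p, hp, hsp, htp, hdisj⟩ := h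
  have hu : u ∈ Γ.argmax p := hsp (by rw [hs]; simp)
  have hv : u + a ∈ Γ.argmax p := hsp (by rw [hs]; simp)
  have he := Cell.isEdge hs
  obtain ⟨b, hp', hd'⟩ : ∃ b, Γ.argmax p = {u, u + a, u + b, u + a + b} ∧
      |latticeDet u (u + a) (u + b)| = 1 := by
    obtain ⟨a', b, h, hd⟩ := hp.corner hu
    rcases IsNode.eq_or_eq h hd he hv with h0 | h0
    · obtain rfl := add_left_cancel h0
      exact ⟨b, h, hd⟩
    · obtain rfl := add_left_cancel h0
      exact ⟨a', IsNode.swap h hd⟩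
  refine ⟨p, b, hp', hd', ?_⟩
  obtain ⟨y, z, ht, hyz⟩ := t.exists_pair
  have hy : y = u + b ∨ y = u + a + b := by
    have h1 : y ∈ Γ.argmax p := htp (by rw [ht]; simp)
    have h2 : y ∉ s.1 := Set.disjoint_right.1 hdisj (by rw [ht]; simp)
    rw [hp'] at h1
    rw [hs] at h2
    simp only [Set.mem_insert_iff, Set.mem_singleton_iff] at h1 h2
    tauto
  have hz : z = u + b ∨ z = u + a + b := by
    have h1 : z ∈ Γ.argmax p := htp (by rw [ht]; simp)
    have h2 : z ∉ s.1 := Set.disjoint_right.1 hdisj (by rw [ht]; simp)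
    rw [hp'] at h1
    rw [hs] at h2
    simp only [Set.mem_insert_iff, Set.mem_singleton_iff] at h1 h2
    tauto
  rw [ht]
  rcases hy with rfl | rfl <;> rcases hz with rfl | rfl
  · exact absurd rfl hyz.1
  · rfl
  · exact Set.pair_comm _ _
  · exact absurd rfl hyz.1

theorem continueThroughNode_of_parallelogram (h : Γ.argmax x = {u, u + a, u + b, u + a + b})
    (hd : |latticeDet u (u + a) (u + b)| = 1) {s t : Γ.Cell} (hs : s.1 = {u, u + a})
    (ht : t.1 = {u + b, u + a + b}) : Γ.ContinueThroughNode s t := by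
  refine ⟨x, ⟨u, a, b, h, hd⟩, ?_, ?_, ?_⟩
  · rw [hs, h]; intro z; simp; tauto
  · rw [ht, h]; intro z; simp; tauto
  · obtain ⟨ha, hb, hab, hab'⟩ := parallelogram_ne hd
    rw [hs, ht, Set.disjoint_left]
    rintro _ (rfl | rfl) (h0 | h0)
    · exact hb (by simpa using h0)
    · exact hab' (by simpa [add_assoc] using h0)
    · exact hab (by simpa using h0)
    · have h0 : u + a = u + a + b := h0
      exact hb (by simpa using h0)

/-- A property of cells which is passed on through nodes is a property of strands. -/
theorem of_strandOf_eq {P : Γ.Cell → Prop} (hP : ∀ s t, Γ.ContinueThroughNode s t → P s → P t)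
    {s t : Γ.Cell} (h : Γ.strandOf s = Γ.strandOf t) (hs : P s) : P t := by
  have := congrArg (Quot.lift P fun s t h => propext ⟨hP s t h, hP t s h.symm⟩) h
  exact this.mp hs

theorem Flag.ext' {d d' : Γ.Flag} (h : d.vertex = d'.vertex) (h' : d.cell = d'.cell) : d = d' := by
  cases d; cases d'; cases h; cases h'; rfl

/-- Two different sides of a triangle are not translates of each other: the third corner does not
lie on the line through `u` in direction `a`. -/
theorem eq_of_parallel_sides (h : Γ.IsTriangle x) (ha : a ≠ 0) (hu : u ∈ Γ.argmax x)
    (hu' : u + a ∈ Γ.argmax x) (hv : v ∈ Γ.argmax x) (hv' : v + a ∈ Γ.argmax x) : u = v := by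
  have hne : u ≠ u + a := by simpa using ha
  obtain ⟨w, hx, hd⟩ : ∃ w, Γ.argmax x = {u, u + a, w} ∧ latticeDet u (u + a) w ≠ 0 := by
    obtain ⟨y, z, hx, hd⟩ := h.corner hu
    have hd0 : latticeDet u y z ≠ 0 := by intro h0; simp [h0] at hd
    rw [hx] at hu'
    rcases hu' with h0 | rfl | rfl
    · exact absurd h0.symm hne
    · exact ⟨z, hx, hd0⟩
    · refine ⟨y, by rw [hx, Set.pair_comm], ?_⟩
      rwa [latticeDet_swap_right, neg_ne_zero]
  rw [hx] at hv hv'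
  have hw : ∀ k : ℤ, w ≠ u + k • a := by
    rintro k rfl
    apply hd
    simp [latticeDet]; ring
  rcases hv with rfl | rfl | hv
  · rfl
  · exfalso
    rcases hv' with h0 | h0 | h0
    · have h0 : (2 : ℤ) • a = 0 := by
        rw [two_smul, ← add_left_cancel_iff (a := u), ← add_assoc, h0, add_zero]
      exact ha ((smul_eq_zero.1 h0).resolve_left two_ne_zero)
    · exact ha (by simpa using h0)
    · exact hw 2 (by rw [← (show _ = w from h0), two_smul, add_assoc])
  · exfalso
    have hv : v = w := hv
    rw [hv] at hv'
    rcases hv' with h0 | h0 | h0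
    · exact hw (-1) (by rw [← h0]; simp)
    · exact hw 0 (by simpa using h0)
    · exact ha (by simpa using (show w + a = w from h0))

/-- Both differences are affine functions with linear part `-a`, and both vanish at the node, so
they coincide. -/
theorem term_sub_translate (h : Γ.argmax x = {u, u + a, u + b, u + a + b}) (y : ℝ × ℝ) :
    Γ.term (u + b) y - Γ.term (u + b + a) y = Γ.term u y - Γ.term (u + a) y := by
  have h1 : Γ.term u x = Γ.term (u + a) x := term_eq (by rw [h]; simp) (by rw [h]; simp)
  have h2 : Γ.term (u + b) x = Γ.term (u + b + a) x :=
    term_eq (by rw [h]; simp) (by rw [h, add_right_comm]; simp)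
  simp only [term, Prod.fst_add, Prod.snd_add] at h1 h2 ⊢
  push_cast at h1 h2 ⊢
  linarith

/-- The cells of a strand lie on one line. -/
theorem exists_translate_of_strandOf_eq {s t : Γ.Cell} (h : Γ.strandOf s = Γ.strandOf t)
    (hs : s.1 = {u, u + a}) : ∃ z, t.1 = {z, z + a} ∧
      ∀ x, Γ.term z x - Γ.term (z + a) x = Γ.term u x - Γ.term (u + a) x := by
  refine of_strandOf_eq (P := fun t => ∃ z, t.1 = {z, z + a} ∧
      ∀ x, Γ.term z x - Γ.term (z + a) x = Γ.term u x - Γ.term (u + a) x) ?_ h ⟨u, hs, fun _ => rfl⟩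
  rintro s t h ⟨z, hs, hz⟩
  obtain ⟨p, b, hp, -, ht⟩ := h.exists_parallelogram hs
  refine ⟨z + b, by rw [ht, add_right_comm], fun x => ?_⟩
  rw [← hz, term_sub_translate hp]

/-- If a cell of a strand is a ray, then the strand ends at most at one vertex, hence is
unbounded. -/
theorem exists_latticeDet_pos {s : Γ.Cell} (h : ¬ Γ.IsPruned (Γ.strandOf s))
    (hs : s.1 = {u, v}) : ∃ w ∈ Γ.support, 0 < latticeDet u v w := by
  by_contra! H
  obtain ⟨a, rfl⟩ : ∃ a, v = u + a := ⟨v - u, by abel⟩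
  have hne := (Cell.isEdge hs).1
  have ha : a ≠ 0 := by simpa using hne
  have hpos := sq_add_sq_pos_of_ne_zero ha
  -- With no exponent on the left of `u v`, no term catches up in this direction, and the cell is
  -- unbounded there.
  have hfar : ∀ y ∈ Γ.cellSet s, ∀ r : ℝ, 0 ≤ r → y + r • edgeDir u (u + a) ∈ Γ.cellSet s := by
    intro y hy r hr
    have hu : u ∈ Γ.argmax y := hy (by rw [hs]; simp)
    have hv : u + a ∈ Γ.argmax y := hy (by rw [hs]; simp)
    have hu' : u ∈ Γ.argmax (y + r • edgeDir u (u + a)) := by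
      refine ⟨hu.1, fun w hw => sub_nonpos.1 ?_⟩
      rw [term_add_smul_edgeDir]
      have h1 := hu.2 w hw
      have h2 : (latticeDet u (u + a) w : ℝ) ≤ 0 := by exact_mod_cast H w hw
      nlinarith
    change s.1 ⊆ _
    rw [hs]
    rintro z (rfl | rfl)
    · exact hu'
    · refine mem_argmax_of_le hu' hv.1 (sub_nonneg.1 ?_)
      rw [term_add_smul_edgeDir, term_eq hu hv]
      simp [latticeDet, mul_comm]
  -- the vertices of the strand come before all cells of the strand
  have key : ∀ d : Γ.Flag, d.strand = Γ.strandOf s → ∀ t, Γ.strandOf s = Γ.strandOf t →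
      ∀ y ∈ Γ.cellSet t, edgePos a d.vertex ≤ edgePos a y := by
    intro d hd t ht
    have hcol := d.isTriangle.not_isCollinear
    have hline : Γ.term u d.vertex = Γ.term (u + a) d.vertex := by
      obtain ⟨z, hz, hzx⟩ := exists_translate_of_strandOf_eq (t := d.cell) hd.symm hs
      have h1 := hzx d.vertex
      have hm : z ∈ Γ.argmax d.vertex := d.mem (by rw [hz]; simp)
      have hm' : z + a ∈ Γ.argmax d.vertex := d.mem (by rw [hz]; simp)
      rw [term_eq hm hm'] at h1
      linarith
    refine (of_strandOf_eq (P := fun t => (∃ z, t.1 = {z, z + a} ∧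
        Γ.term z d.vertex = Γ.term (z + a) d.vertex) ∧
        ∀ y ∈ Γ.cellSet t, edgePos a d.vertex ≤ edgePos a y) ?_ ht ⟨⟨u, hs, hline⟩, ?_⟩).2
    · rintro s t hst ⟨⟨z, hs, hz⟩, hsy⟩
      obtain ⟨p, b, hp, hdet, ht⟩ := hst.exists_parallelogram hs
      have hp1 : z + b ∈ Γ.argmax p := by rw [hp]; simp
      have hp2 : z + b + a ∈ Γ.argmax p := by rw [hp, add_right_comm]; simp
      have ht' : t.1 = {z + b, z + b + a} := by rw [ht, add_right_comm]
      have hz' : Γ.term (z + b) d.vertex = Γ.term (z + b + a) d.vertex := by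
        have h1 := term_sub_translate hp d.vertex
        rw [hz] at h1
        linarith
      refine ⟨⟨z + b, ht', hz'⟩, fun y hy => ?_⟩
      -- Otherwise the vertex would lie strictly between `y` and the node `p`, in the interior of
      -- the cell `t`. The inequality at `p` is strict because a node is not a vertex.
      by_contra! hlt
      have hps : p ∈ Γ.cellSet s := by
        change s.1 ⊆ _
        rw [hs, hp]; intro; simp; tauto
      have hpx : edgePos a d.vertex < edgePos a p := by
        refine lt_of_le_of_ne (hsy p hps) fun h0 => ?_
        have := eq_of_edgePos_eq ha hz' (term_eq hp1 hp2) h0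
        have hn : Γ.IsNode p := ⟨z, a, b, hp, hdet⟩
        exact hn.not_isTriangle (this ▸ d.isTriangle)
      exact hcol (isCollinear_of_between ha (hy (by rw [ht']; simp)) (hy (by rw [ht']; simp))
        hp1 hp2 hz' hlt hpx)
    · intro y hy
      by_contra! hlt
      -- This `r` moves `y` to the position one unit beyond the vertex, still inside the unbounded
      -- cell.
      set r := (edgePos a d.vertex - edgePos a y + 1) / ((a.1 : ℝ) ^ 2 + (a.2 : ℝ) ^ 2) with hr
      have hy' := hfar y hy r (div_nonneg (by linarith) hpos.le)
      refine hcol (isCollinear_of_between ha (hy (by rw [hs]; simp)) (hy (by rw [hs]; simp))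
        (hy' (by rw [hs]; simp)) (hy' (by rw [hs]; simp)) hline hlt ?_)
      rw [edgePos_add_smul, hr, div_mul_cancel₀ _ hpos.ne']
      linarith
  -- By `key` in both directions, two flags of the strand have the same position and hence the same
  -- vertex; a triangle has only one side with difference vector `a`, so their cells agree too.
  refine h (IsPruned.unbounded _ fun d d' hd hd' => ?_)
  obtain ⟨z, hz, hzx⟩ := exists_translate_of_strandOf_eq (t := d.cell) hd.symm hs
  obtain ⟨z', hz', hzx'⟩ := exists_translate_of_strandOf_eq (t := d'.cell) hd'.symm hs
  have hmem : z ∈ Γ.argmax d.vertex := d.mem (by rw [hz]; simp)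
  have hmem₂ : z + a ∈ Γ.argmax d.vertex := d.mem (by rw [hz]; simp)
  have hmem' : z' ∈ Γ.argmax d'.vertex := d'.mem (by rw [hz']; simp)
  have hmem₂' : z' + a ∈ Γ.argmax d'.vertex := d'.mem (by rw [hz']; simp)
  have hxx : d.vertex = d'.vertex := by
    refine eq_of_edgePos_eq (F := Γ.toTropicalPolynomial) (u := z) ha (term_eq hmem hmem₂) ?_
      (le_antisymm (key d hd _ hd'.symm _ d'.mem) (key d' hd' _ hd.symm _ d.mem))
    have h1 := hzx d'.vertex
    rw [← hzx', term_eq hmem' hmem₂'] at h1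
    linarith
  refine Flag.ext' hxx (Subtype.ext ?_)
  rw [← hxx] at hmem' hmem₂'
  rw [hz, hz', eq_of_parallel_sides d.isTriangle ha hmem hmem₂ hmem' hmem₂']

/-- A cell that belongs to the skeleton has exactly two ends. -/
theorem Cell.ends_eq_pair {s : Γ.Cell} (h : ¬ Γ.IsPruned (Γ.strandOf s)) :
    ∃ y z, y ≠ z ∧ {x | ¬ IsCollinear (Γ.argmax x) ∧ s.1 ⊆ Γ.argmax x} = {y, z} := by
  obtain ⟨u, v, hs, he⟩ := s.exists_pair
  obtain ⟨w, hw, hd⟩ := exists_latticeDet_pos h (hs.trans (Set.pair_comm u v))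
  obtain ⟨y, z, hyz, h'⟩ := NodalTropicalCurve.ends_eq_pair he (exists_latticeDet_pos h hs)
    ⟨w, hw, by rw [latticeDet_swap] at hd; linarith⟩
  refine ⟨y, z, hyz, ?_⟩
  rw [← h', hs]
  ext x
  simp [Set.insert_subset_iff]

end NodalTropicalCurve

/-! ### Walks and bridges in multigraphs -/

theorem Reachable.symm {α β : Type*} {G : Graph α β} {v w : α} (h : Reachable G v w) :
    Reachable G w v :=
  have := Relation.ReflTransGen.stdSymm (r := G.Adj)
  Std.Symm.symm (r := Relation.ReflTransGen G.Adj) _ _ h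

theorem Reachable.mono {α β : Type*} {G H : Graph α β} (hle : G ≤ H) {v w : α}
    (h : Reachable G v w) : Reachable H v w :=
  Relation.ReflTransGen.mono (p := H.Adj) (fun _ _ => Graph.Adj.mono hle) _ _ h

/-- A walk either avoids an edge or can be shortened so as to use it only once. -/
theorem Reachable.deleteEdges_cases {α β : Type*} {G : Graph α β} {e : β} {a b v w : α}
    (he : G.IsLink e a b) (h : Reachable G v w) :
    Reachable (G.deleteEdges {e}) v w ∨
      (Reachable (G.deleteEdges {e}) v a ∧ Reachable (G.deleteEdges {e}) b w) ∨
      (Reachable (G.deleteEdges {e}) v b ∧ Reachable (G.deleteEdges {e}) a w) := by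
  induction h with
  | refl => exact Or.inl .refl
  | @tail y z _ hyz ih =>
    obtain ⟨f, hf⟩ := hyz
    by_cases hfe : f = e
    · subst hfe
      rcases he.eq_and_eq_or_eq_and_eq hf with ⟨rfl, rfl⟩ | ⟨rfl, rfl⟩
      · rcases ih with h | ⟨h, -⟩ | ⟨h, -⟩
        · exact Or.inr (Or.inl ⟨h, .refl⟩)
        · exact Or.inr (Or.inl ⟨h, .refl⟩)
        · exact Or.inl h
      · rcases ih with h | ⟨h, -⟩ | ⟨h, -⟩
        · exact Or.inr (Or.inr ⟨h, .refl⟩)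
        · exact Or.inl h
        · exact Or.inr (Or.inr ⟨h, .refl⟩)
    · have hadj : (G.deleteEdges {e}).Adj y z := ⟨f, by simp [hf, hfe]⟩
      rcases ih with h | ⟨h, h'⟩ | ⟨h, h'⟩
      · exact Or.inl (h.tail hadj)
      · exact Or.inr (Or.inl ⟨h, h'.tail hadj⟩)
      · exact Or.inr (Or.inr ⟨h, h'.tail hadj⟩)

/-- If the removal of `e` separates any two connected vertices, the walk between them used `e`, and
a detour joining the ends of `e` would repair it. -/
theorem isBridge_iff {α β : Type*} {G : Graph α β} {e : β} {a b : α} (he : G.IsLink e a b) :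
    IsBridge G e ↔ ¬ Reachable (G.deleteEdges {e}) a b := by
  constructor
  · rintro ⟨-, v, -, w, -, h, h'⟩ hab
    rcases h.deleteEdges_cases he with h | ⟨h1, h2⟩ | ⟨h1, h2⟩
    · exact h' h
    · exact h' (h1.trans (hab.trans h2))
    · exact h' (h1.trans (Reachable.symm hab |>.trans h2))
  · intro h
    exact ⟨he.edge_mem, a, he.left_mem, b, he.right_mem, .single he.adj, h⟩

/-- The ends of an edge which is not a bridge remain connected when this edge and any finite
number of bridges are deleted. -/
theorem reachable_deleteEdges_insert {α β : Type*} {G : Graph α β} {e : β} {a b : α}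
    (he : G.IsLink e a b) (hne : ¬ IsBridge G e) {F : Set β} (hF : F.Finite)
    (hFb : ∀ f ∈ F, IsBridge G f) : Reachable (G.deleteEdges (insert e F)) a b := by
  induction F, hF using Set.Finite.induction_on with
  | empty =>
    rw [isBridge_iff he, not_not] at hne
    simpa using hne
  | @insert f F hfF _ ih =>
    have hf := hFb f (Set.mem_insert f F)
    have h := ih fun g hg => hFb g (Set.mem_insert_of_mem f hg)
    obtain ⟨c, d, hcd⟩ := Graph.exists_isLink_of_mem_edgeSet hf.1
    have hfe : f ≠ e := by rintro rfl; exact hne hf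
    have hset : (G.deleteEdges (insert e F)).deleteEdges {f} =
        G.deleteEdges (insert e (insert f F)) := by
      rw [Graph.deleteEdges_deleteEdges]
      congr 1
      ext; simp; tauto
    have hle : (G.deleteEdges (insert e F)).deleteEdges {f} ≤ G.deleteEdges {f} :=
      Graph.deleteEdges_mono_left Graph.deleteEdges_le _
    have hab : Reachable (G.deleteEdges {f}) a b :=
      .single ⟨e, by simp [he, hfe.symm]⟩
    rw [isBridge_iff hcd] at hf
    have hcd' : (G.deleteEdges (insert e F)).IsLink f c d := by simp [hcd, hfe, hfF]
    rw [← hset]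
    -- If the walk from `a` to `b` needed the bridge `f`, its two pieces together with the edge `e`
    -- would join the ends of `f` without using `f`.
    rcases h.deleteEdges_cases hcd' with h | ⟨h1, h2⟩ | ⟨h1, h2⟩
    · exact h
    · exact absurd ((h1.mono hle).symm.trans (hab.trans (h2.mono hle).symm)) hf
    · exact absurd ((h2.mono hle).trans (hab.symm.trans (h1.mono hle))) hf

/-! ### Chains modulo 2 on the cells and on the skeleton -/

namespace NodalTropicalCurve

open TropicalPolynomial

variable {Γ : NodalTropicalCurve} {x y : ℝ × ℝ} {u v w a b : ℤ × ℤ}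

noncomputable instance : Fintype Γ.Cell := Fintype.ofFinite _

instance : Finite Γ.SkeletonEdge := by
  have : Finite Γ.Strand := Finite.of_surjective _ Quot.mk_surjective
  have : Finite Γ.CoreStrand := Subtype.finite
  exact Finite.of_surjective _ Quot.mk_surjective

open Classical in
/-- The sum of the values of a function at the cells which contain a given point. -/
noncomputable def vertexSum (g : Γ.Cell → ZMod 2) (x : ℝ × ℝ) : ZMod 2 :=
  ∑ s : Γ.Cell with s.1 ⊆ Γ.argmax x, g s

theorem vertexSum_add (f g : Γ.Cell → ZMod 2) (x : ℝ × ℝ) :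
    vertexSum (f + g) x = vertexSum f x + vertexSum g x :=
  Finset.sum_add_distrib

open Classical in
theorem filter_cells_triangle (h : Γ.argmax x = {u, v, w}) {r s t : Γ.Cell} (hr : r.1 = {u, v})
    (hs : s.1 = {u, w}) (ht : t.1 = {v, w}) :
    (Finset.univ.filter fun s : Γ.Cell => s.1 ⊆ Γ.argmax x) = {r, s, t} := by
  ext c
  simp only [Finset.mem_filter, Finset.mem_univ, true_and, Finset.mem_insert,
    Finset.mem_singleton, h]
  constructor
  · intro hc
    obtain ⟨y, z, hyz, he⟩ := c.exists_pair
    rw [hyz, Set.insert_subset_iff, Set.singleton_subset_iff] at hc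
    have hne := he.1
    have hpair := Set.pair_comm y z
    rcases hc with ⟨rfl | rfl | rfl, rfl | rfl | rfl⟩
    all_goals first
      | exact absurd rfl hne
      | exact Or.inl (Subtype.ext (hyz.trans hr.symm))
      | exact Or.inr (Or.inl (Subtype.ext (hyz.trans hs.symm)))
      | exact Or.inr (Or.inr (Subtype.ext (hyz.trans ht.symm)))
      | exact Or.inl (Subtype.ext (hyz.trans (hpair.trans hr.symm)))
      | exact Or.inr (Or.inl (Subtype.ext (hyz.trans (hpair.trans hs.symm))))
      | exact Or.inr (Or.inr (Subtype.ext (hyz.trans (hpair.trans ht.symm))))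
  · rintro (rfl | rfl | rfl)
    · rw [hr]; intro; simp; tauto
    · rw [hs]; intro; simp; tauto
    · rw [ht]; intro; simp; tauto

theorem vertexSum_triangle (g : Γ.Cell → ZMod 2) (h : Γ.argmax x = {u, v, w})
    (hd : |latticeDet u v w| = 1) {r s t : Γ.Cell} (hr : r.1 = {u, v}) (hs : s.1 = {u, w})
    (ht : t.1 = {v, w}) : vertexSum g x = g r + g s + g t := by
  classical
  obtain ⟨h1, h2, h3⟩ := ne_of_abs_latticeDet_eq_one hd
  have hrs : r ≠ s := by
    rintro rfl
    have : v ∈ r.1 := by rw [hr]; simp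
    rw [hs] at this
    rcases this with rfl | rfl
    · exact h1 rfl
    · exact h3 rfl
  have hrt : r ≠ t := by
    rintro rfl
    have : u ∈ r.1 := by rw [hr]; simp
    rw [ht] at this
    rcases this with rfl | rfl
    · exact h1 rfl
    · exact h2 rfl
  have hst : s ≠ t := by
    rintro rfl
    have : u ∈ s.1 := by rw [hs]; simp
    rw [ht] at this
    rcases this with rfl | rfl
    · exact h1 rfl
    · exact h2 rfl
  rw [vertexSum, filter_cells_triangle h hr hs ht, Finset.sum_insert (by simp [hrs, hrt]),
    Finset.sum_pair hst, add_assoc]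

theorem not_isEdge_diagonal (h : Γ.argmax x = {u, u + a, u + b, u + a + b})
    (hd : |latticeDet u (u + a) (u + b)| = 1) :
    ¬ Γ.IsEdge u (u + a + b) ∧ ¬ Γ.IsEdge (u + a) (u + b) := by
  obtain ⟨ha, hb, -, -⟩ := parallelogram_ne hd
  constructor
  · intro he
    rcases IsNode.eq_or_eq h hd he (by rw [h]; simp) with h0 | h0
    · exact hb (by simpa using h0)
    · rw [add_right_comm] at h0
      exact ha (by simpa using h0)
  · intro he
    -- From the corner `u + a`, with `-a` in place of `a`, the second diagonal takes the place of
    -- the first.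
    have h' : Γ.argmax x = {u + a, u + a + -a, u + a + b, u + a + -a + b} := by
      rw [h]; ext z; simp; tauto
    have hd' : |latticeDet (u + a) (u + a + -a) (u + a + b)| = 1 := by
      rw [latticeDet_add] at hd ⊢
      rw [← hd, ← abs_neg]; congr 1; simp; ring
    rcases IsNode.eq_or_eq h' hd' he (by rw [h]; simp) with h0 | h0
    · exact hb (by simpa using h0)
    · rw [add_right_comm] at h0
      exact ha (by simpa using h0)

open Classical in
theorem filter_cells_node (h : Γ.argmax x = {u, u + a, u + b, u + a + b})
    (hd : |latticeDet u (u + a) (u + b)| = 1) {r r' s s' : Γ.Cell} (hr : r.1 = {u, u + a})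
    (hr' : r'.1 = {u + b, u + a + b}) (hs : s.1 = {u, u + b}) (hs' : s'.1 = {u + a, u + a + b}) :
    (Finset.univ.filter fun s : Γ.Cell => s.1 ⊆ Γ.argmax x) = {r, r', s, s'} := by
  obtain ⟨hn, hn'⟩ := not_isEdge_diagonal h hd
  ext c
  simp only [Finset.mem_filter, Finset.mem_univ, true_and, Finset.mem_insert,
    Finset.mem_singleton, h]
  constructor
  · intro hc
    obtain ⟨y, z, hyz, he⟩ := c.exists_pair
    rw [hyz, Set.insert_subset_iff, Set.singleton_subset_iff] at hc
    have hpair := Set.pair_comm y z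
    rcases hc with ⟨rfl | rfl | rfl | rfl, rfl | rfl | rfl | rfl⟩
    all_goals first
      | exact absurd rfl he.1
      | exact absurd he hn
      | exact absurd he.symm hn
      | exact absurd he hn'
      | exact absurd he.symm hn'
      | exact Or.inl (Subtype.ext (hyz.trans hr.symm))
      | exact Or.inr (Or.inl (Subtype.ext (hyz.trans hr'.symm)))
      | exact Or.inr (Or.inr (Or.inl (Subtype.ext (hyz.trans hs.symm))))
      | exact Or.inr (Or.inr (Or.inr (Subtype.ext (hyz.trans hs'.symm))))
      | exact Or.inl (Subtype.ext (hyz.trans (hpair.trans hr.symm)))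
      | exact Or.inr (Or.inl (Subtype.ext (hyz.trans (hpair.trans hr'.symm))))
      | exact Or.inr (Or.inr (Or.inl (Subtype.ext (hyz.trans (hpair.trans hs.symm)))))
      | exact Or.inr (Or.inr (Or.inr (Subtype.ext (hyz.trans (hpair.trans hs'.symm)))))
  · rintro (rfl | rfl | rfl | rfl)
    · rw [hr]; intro; simp; tauto
    · rw [hr']; intro; simp; tauto
    · rw [hs]; intro; simp; tauto
    · rw [hs']; intro; simp; tauto

theorem vertexSum_node (g : Γ.Cell → ZMod 2) (h : Γ.argmax x = {u, u + a, u + b, u + a + b})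
    (hd : |latticeDet u (u + a) (u + b)| = 1) {r r' s s' : Γ.Cell} (hr : r.1 = {u, u + a})
    (hr' : r'.1 = {u + b, u + a + b}) (hs : s.1 = {u, u + b}) (hs' : s'.1 = {u + a, u + a + b}) :
    vertexSum g x = (g r + g r') + (g s + g s') := by
  classical
  obtain ⟨ha, hb, hab, hab'⟩ := parallelogram_ne hd
  have ha' : b ≠ a + b := by simpa using ha
  have hb' : a ≠ a + b := by simpa using hb
  have ne : ∀ {c c' : Γ.Cell} {z}, z ∈ c.1 → z ∉ c'.1 → c ≠ c' := by
    rintro c c' z hz hz' rfl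
    exact hz' hz
  have h1 : r ≠ r' := ne (z := u) (by rw [hr]; simp) (by rw [hr']; simp [add_assoc, *, Ne.symm])
  have h2 : r ≠ s := ne (z := u + a) (by rw [hr]; simp) (by rw [hs]; simp [*])
  have h3 : r ≠ s' := ne (z := u) (by rw [hr]; simp) (by rw [hs']; simp [add_assoc, *])
  have h4 : r' ≠ s := ne (z := u + a + b) (by rw [hr']; simp)
    (by rw [hs]; simp [add_assoc, *])
  have h5 : r' ≠ s' := ne (z := u + b) (by rw [hr']; simp)
    (by rw [hs']; simp [add_assoc, hab.symm, ha])
  have h6 : s ≠ s' := ne (z := u) (by rw [hs]; simp) (by rw [hs']; simp [add_assoc, *])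
  rw [vertexSum, filter_cells_node h hd hr hr' hs hs', Finset.sum_insert (by simp [*]),
    Finset.sum_insert (by simp [*]), Finset.sum_pair h6]
  ring

/-- Every function on the cells of the skeleton is counted twice by its sums at the triangles
and nodes. -/
theorem sum_vertexSum (g : Γ.Cell → ZMod 2) (hg : ∀ s, Γ.IsPruned (Γ.strandOf s) → g s = 0) :
    ∑ x ∈ Γ.finite_noncollinear.toFinset, vertexSum g x = 0 := by
  classical
  simp only [vertexSum, Finset.sum_filter]
  rw [Finset.sum_comm]
  refine Finset.sum_eq_zero fun s _ => ?_
  by_cases h : Γ.IsPruned (Γ.strandOf s)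
  · simp [hg s h]
  obtain ⟨y, z, hyz, hset⟩ := Cell.ends_eq_pair h
  have : (Γ.finite_noncollinear.toFinset.filter fun x => s.1 ⊆ Γ.argmax x) = {y, z} := by
    ext t
    have := Set.ext_iff.1 hset t
    simpa using this
  rw [← Finset.sum_filter, this, Finset.sum_pair hyz]
  exact (by decide : ∀ c : ZMod 2, c + c = 0) _

open Classical in
/-- A function on the edges of the skeleton as a function on cells. -/
noncomputable def cellValue (f : Γ.SkeletonEdge → ZMod 2) (s : Γ.Cell) : ZMod 2 :=
  if h : ¬ Γ.IsPruned (Γ.strandOf s) then f (Γ.skeletonEdgeOf ⟨_, h⟩) else 0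

theorem cellValue_of_core (f : Γ.SkeletonEdge → ZMod 2) {s : Γ.Cell}
    (h : ¬ Γ.IsPruned (Γ.strandOf s)) :
    cellValue f s = f (Γ.skeletonEdgeOf ⟨Γ.strandOf s, h⟩) :=
  dif_pos h

theorem cellValue_of_isPruned (f : Γ.SkeletonEdge → ZMod 2) {s : Γ.Cell}
    (h : Γ.IsPruned (Γ.strandOf s)) : cellValue f s = 0 :=
  dif_neg (not_not.2 h)

theorem cellValue_add (f g : Γ.SkeletonEdge → ZMod 2) :
    cellValue (f + g) = cellValue f + cellValue g := by
  ext s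
  by_cases h : Γ.IsPruned (Γ.strandOf s)
  · simp [cellValue_of_isPruned, h]
  · simp [cellValue_of_core, h]

theorem cellValue_zero : cellValue (0 : Γ.SkeletonEdge → ZMod 2) = 0 := by
  ext s
  by_cases h : Γ.IsPruned (Γ.strandOf s)
  · simp [cellValue_of_isPruned, h]
  · simp [cellValue_of_core, h]

theorem cellValue_congr (f : Γ.SkeletonEdge → ZMod 2) {s t : Γ.Cell}
    (h : Γ.strandOf s = Γ.strandOf t) : cellValue f s = cellValue f t := by
  by_cases hs : Γ.IsPruned (Γ.strandOf s)
  · rw [cellValue_of_isPruned f hs, cellValue_of_isPruned f (h ▸ hs)]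
  · rw [cellValue_of_core f hs, cellValue_of_core f (h ▸ hs)]
    congr 2
    exact Subtype.ext h

theorem vertexSum_zero (x : ℝ × ℝ) : vertexSum (0 : Γ.Cell → ZMod 2) x = 0 :=
  Finset.sum_const_zero

theorem isTriangle_of_coreDegree_eq_three (h : Γ.coreDegree x = 3) : Γ.IsTriangle x := by
  have : {d : Γ.Flag | d.vertex = x ∧ ¬ Γ.IsPruned d.strand}.Nonempty := by
    rw [← Set.encard_ne_zero]
    intro h0
    rw [coreDegree, h0] at h
    exact absurd h (by decide)
  obtain ⟨d, rfl, -⟩ := this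
  exact d.isTriangle

open Classical in
theorem coreDegree_eq_card (hx : Γ.IsTriangle x) : Γ.coreDegree x =
    ((Finset.univ.filter fun s : Γ.Cell =>
      s.1 ⊆ Γ.argmax x ∧ ¬ Γ.IsPruned (Γ.strandOf s)).card : ℕ∞) := by
  have hinj : Set.InjOn Flag.cell {d : Γ.Flag | d.vertex = x ∧ ¬ Γ.IsPruned d.strand} :=
    fun d hd d' hd' h => Flag.ext' (hd.1.trans hd'.1.symm) h
  rw [coreDegree, ← hinj.encard_image, ← Set.encard_coe_eq_coe_finsetCard]
  congr 1
  ext s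
  simp only [Set.mem_image, Set.mem_ofPred_eq, Finset.coe_filter, Finset.mem_univ, true_and]
  constructor
  · rintro ⟨d, ⟨rfl, hd⟩, rfl⟩
    exact ⟨d.mem, hd⟩
  · rintro ⟨hs, hs'⟩
    exact ⟨⟨x, s, hx, hs⟩, ⟨rfl, hs'⟩, rfl⟩

open Classical in
theorem card_core_cells_le (hx : Γ.IsTriangle x) : (Finset.univ.filter fun s : Γ.Cell =>
    s.1 ⊆ Γ.argmax x ∧ ¬ Γ.IsPruned (Γ.strandOf s)).card ≤ 3 := by
  obtain ⟨u, v, w, huvw, hd⟩ := hx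
  obtain ⟨h1, h2, h3⟩ := IsTriangle.isEdge huvw hd
  refine le_trans (Finset.card_le_card (t := {cellOfEdge h1, cellOfEdge h2, cellOfEdge h3}) ?_)
    Finset.card_le_three
  rw [← filter_cells_triangle huvw rfl rfl rfl]
  exact Finset.monotone_filter_right _ fun _ _ h => h.1

/-- Two different remaining cells at such a vertex force the degree to be two, and smoothing
identifies their skeleton edges. -/
theorem skeletonEdgeOf_eq_of_coreDegree_ne_three (hx : Γ.IsTriangle x) (h : Γ.coreDegree x ≠ 3)
    {s t : Γ.Cell} (hsx : s.1 ⊆ Γ.argmax x) (htx : t.1 ⊆ Γ.argmax x)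
    (hs : ¬ Γ.IsPruned (Γ.strandOf s)) (ht : ¬ Γ.IsPruned (Γ.strandOf t)) :
    Γ.skeletonEdgeOf ⟨_, hs⟩ = Γ.skeletonEdgeOf ⟨_, ht⟩ := by
  classical
  by_cases hst : s = t
  · subst hst; rfl
  refine Quot.sound ⟨⟨x, s, hx, hsx⟩, ⟨x, t, hx, htx⟩, fun h0 => hst (congrArg Flag.cell h0), rfl,
    ?_, rfl, rfl⟩
  have hle := card_core_cells_le hx
  have hge := Finset.card_le_card (s := {s, t}) (t := Finset.univ.filter fun s : Γ.Cell =>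
    s.1 ⊆ Γ.argmax x ∧ ¬ Γ.IsPruned (Γ.strandOf s)) (by
      simp [Finset.insert_subset_iff, hsx, htx, hs, ht])
  rw [Finset.card_pair hst] at hge
  rw [coreDegree_eq_card hx] at h
  change Γ.coreDegree x = 2
  rw [coreDegree_eq_card hx]
  interval_cases hc : (Finset.univ.filter fun s : Γ.Cell =>
    s.1 ⊆ Γ.argmax x ∧ ¬ Γ.IsPruned (Γ.strandOf s)).card
  · rfl
  · exact absurd rfl h

/-- Every chain on the skeleton is closed at the vertices that are not trivalent: nothing remains in
degree zero, degree one does not survive the pruning, and in degree two the two values are equal and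
cancel. -/
theorem vertexSum_of_coreDegree_ne_three (f : Γ.SkeletonEdge → ZMod 2) (hx : Γ.IsTriangle x)
    (h : Γ.coreDegree x ≠ 3) : vertexSum (cellValue f) x = 0 := by
  classical
  set T := Finset.univ.filter fun s : Γ.Cell => s.1 ⊆ Γ.argmax x ∧ ¬ Γ.IsPruned (Γ.strandOf s)
    with hT
  have hmem : ∀ s, s ∈ T ↔ s.1 ⊆ Γ.argmax x ∧ ¬ Γ.IsPruned (Γ.strandOf s) := by simp [hT]
  have hcard : Γ.coreDegree x = (T.card : ℕ∞) := by rw [coreDegree_eq_card hx]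
  have hsum : vertexSum (cellValue f) x = ∑ s ∈ T, cellValue f s := by
    rw [vertexSum]
    refine (Finset.sum_subset (fun s hs => ?_) fun s hs hs' => ?_).symm
    · simp [((hmem s).1 hs).1]
    · simp only [Finset.mem_filter, Finset.mem_univ, true_and] at hs
      rw [hmem, not_and, not_not] at hs'
      exact cellValue_of_isPruned f (hs' hs)
  have hle : T.card ≤ 3 := card_core_cells_le hx
  rw [hsum]
  interval_cases hc : T.card
  · rw [Finset.card_eq_zero.1 hc, Finset.sum_empty]
  · obtain ⟨s, hs⟩ := Finset.card_eq_one.1 hc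
    obtain ⟨hsx, hsp⟩ := (hmem s).1 (by rw [hs]; simp)
    refine absurd (IsPruned.leaf (⟨x, s, hx, hsx⟩ : Γ.Flag) fun d hd hne => ?_) hsp
    by_contra hdp
    have : d.cell ∈ T := (hmem _).2 ⟨by have := d.mem; rw [hd] at this; exact this, hdp⟩
    rw [hs, Finset.mem_singleton] at this
    exact hne (Flag.ext' hd this)
  · obtain ⟨s, t, hst, hT'⟩ := Finset.card_eq_two.1 hc
    obtain ⟨hsx, hsp⟩ := (hmem s).1 (by rw [hT']; simp)
    obtain ⟨htx, htp⟩ := (hmem t).1 (by rw [hT']; simp)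
    rw [hT', Finset.sum_pair hst, cellValue_of_core f hsp, cellValue_of_core f htp,
      skeletonEdgeOf_eq_of_coreDegree_ne_three hx h hsx htx hsp htp]
    exact (by decide : ∀ c : ZMod 2, c + c = 0) _
  · exact absurd (by rw [hcard]; rfl) h

open Classical in
/-- The indicator function of a vertex of the skeleton on the trivalent points. -/
noncomputable def branchIndicator (v : Γ.SkeletonVertex) (x : ℝ × ℝ) : ZMod 2 :=
  if v = .branch x then 1 else 0

/-- This is the boundary of a skeleton edge. Counting flags rather than vertices treats a loop at a
trivalent point correctly, as its two ends cancel; a circle has no ends at trivalent points. -/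
theorem vertexSum_single [DecidableEq Γ.SkeletonEdge] {e : Γ.SkeletonEdge}
    {v w : Γ.SkeletonVertex} (he : Γ.IsSkeletonLink e v w) (hx : Γ.coreDegree x = 3) :
    vertexSum (cellValue (Pi.single e 1)) x = branchIndicator v x + branchIndicator w x := by
  classical
  have hend : ∀ s : Γ.Cell, ∀ hs : s.1 ⊆ Γ.argmax x,
      cellValue (Pi.single e 1) s =
        if Γ.IsEnd e ⟨x, s, isTriangle_of_coreDegree_eq_three hx, hs⟩ then 1 else 0 := by
    intro s hs
    by_cases h : Γ.IsPruned (Γ.strandOf s)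
    · rw [cellValue_of_isPruned _ h, if_neg]
      rintro ⟨-, h', -⟩
      exact h' h
    · rw [cellValue_of_core _ h, Pi.single_apply]
      refine if_congr ?_ rfl rfl
      exact ⟨fun h' => ⟨hx, h, h'⟩, fun ⟨_, _, h'⟩ => h'⟩
  rcases he with ⟨d, d', hne, hset, rfl, rfl⟩ | ⟨hno, rfl, rfl⟩
  · have hiff : ∀ f, Γ.IsEnd e f ↔ f = d ∨ f = d' := fun f => Set.ext_iff.1 hset f
    have hsum : branchIndicator (Γ := Γ) (.branch d.vertex) x +
          branchIndicator (Γ := Γ) (.branch d'.vertex) x =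
        ∑ f ∈ ({d, d'} : Finset Γ.Flag).filter (fun f => f.vertex = x), (1 : ZMod 2) := by
      rw [Finset.sum_filter, Finset.sum_pair hne]
      simp [branchIndicator]
    rw [hsum, vertexSum]
    symm
    refine Finset.sum_of_injOn Flag.cell ?_ ?_ ?_ ?_
    · intro f hf f' hf' h
      simp only [Finset.coe_filter, Set.mem_ofPred_eq] at hf hf'
      exact Flag.ext' (hf.2.trans hf'.2.symm) h
    · intro f hf
      simp only [Finset.coe_filter, Set.mem_ofPred_eq] at hf
      obtain ⟨-, rfl⟩ := hf
      simpa using (show f.cell.1 ⊆ Γ.argmax f.vertex from f.mem)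
    · intro s hs hs'
      simp only [Finset.mem_filter, Finset.mem_univ, true_and] at hs
      rw [hend s hs, if_neg]
      intro h
      rw [hiff] at h
      exact hs' ⟨⟨x, s, isTriangle_of_coreDegree_eq_three hx, hs⟩, by simpa using h, rfl⟩
    · intro f hf
      simp only [Finset.mem_filter, Finset.mem_insert, Finset.mem_singleton] at hf
      obtain ⟨hf, rfl⟩ := hf
      rw [hend f.cell f.mem, if_pos ((hiff _).2 hf)]
  · rw [vertexSum, Finset.sum_eq_zero]
    · simp [branchIndicator]
    · intro s hs
      simp only [Finset.mem_filter, Finset.mem_univ, true_and] at hs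
      rw [hend s hs, if_neg (hno _)]

/-- A walk in a subgraph of the skeleton, as a `1`-chain modulo `2`. -/
theorem exists_chain_of_reachable {H : Graph Γ.SkeletonVertex Γ.SkeletonEdge}
    (hH : H ≤ Γ.skeleton) {v w : Γ.SkeletonVertex} (h : Reachable H v w) :
    ∃ f : Γ.SkeletonEdge → ZMod 2,
      (∀ e, f e ≠ 0 → ∃ y z, H.IsLink e y z ∧ Reachable H v y) ∧
      ∀ x, Γ.coreDegree x = 3 →
        vertexSum (cellValue f) x = branchIndicator v x + branchIndicator w x := by
  classical
  have two : ∀ c : ZMod 2, c + c = 0 := by decide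
  induction h with
  | refl => exact ⟨0, by simp, fun x _ => by rw [cellValue_zero, vertexSum_zero, two]⟩
  | @tail y z hy hyz ih =>
    obtain ⟨f, hf, hfx⟩ := ih
    obtain ⟨e, he⟩ := hyz
    refine ⟨f + Pi.single e 1, fun e' he' => ?_, fun x hx => ?_⟩
    · by_cases h : e' = e
      · subst h; exact ⟨y, z, he, hy⟩
      · exact hf e' (by simpa [h] using he')
    · rw [cellValue_add, vertexSum_add, hfx x hx, vertexSum_single (he.mono hH) hx]
      linear_combination two (branchIndicator y x)

/-- Every edge of a `2`-connected component of the skeleton lies on a cycle modulo `2` in this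
component. -/
theorem exists_cycle {K : Graph Γ.SkeletonVertex Γ.SkeletonEdge}
    (hK : IsTwoConnectedComponent Γ.skeleton K) {e : Γ.SkeletonEdge} (he : e ∈ K.edgeSet) :
    ∃ f : Γ.SkeletonEdge → ZMod 2, f e = 1 ∧ (∀ e', f e' ≠ 0 → e' ∈ K.edgeSet) ∧
      ∀ x, Γ.IsTriangle x → vertexSum (cellValue f) x = 0 := by
  classical
  have two : ∀ c : ZMod 2, c + c = 0 := by decide
  obtain ⟨v, -, rfl⟩ := hK
  obtain ⟨y, z, hyz, hy, hz⟩ := Graph.exists_isLink_of_mem_edgeSet he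
  have hyz' : Γ.skeleton.IsLink e y z ∧ ¬ IsBridge Γ.skeleton e := by simpa using hyz
  -- A walk between the ends of `e` that avoids `e` and all bridges stays in the component, and `e`
  -- closes it to a cycle. As the walk avoids `e`, the coefficient of `e` is `1`.
  have hreach := reachable_deleteEdges_insert hyz'.1 hyz'.2
    (Set.toFinite {e | IsBridge Γ.skeleton e}) fun _ h => h
  have hle : Γ.skeleton.deleteEdges (insert e {e | IsBridge Γ.skeleton e}) ≤
      Γ.skeleton.deleteEdges {e | IsBridge Γ.skeleton e} := by
    rw [← Set.union_singleton, ← Graph.deleteEdges_deleteEdges]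
    exact Graph.deleteEdges_le
  obtain ⟨f, hf, hfx⟩ := exists_chain_of_reachable Graph.deleteEdges_le hreach
  have hfe : f e = 0 := by
    by_contra h
    obtain ⟨y', z', h', -⟩ := hf e h
    simp at h'
  refine ⟨f + Pi.single e 1, by simp [hfe], fun e' he' => ?_, fun x hx => ?_⟩
  · by_cases h : e' = e
    · rwa [h]
    · obtain ⟨y', z', h', hy'⟩ := hf e' (by simpa [h] using he')
      have h1 := h'.mono hle
      have h2 : Reachable _ v y' := Relation.ReflTransGen.trans hy (hy'.mono hle)
      have h3 : Reachable _ v z' := h2.tail h1.adj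
      exact Graph.IsLink.edge_mem (x := y') (y := z') ⟨h1, h2, h3⟩
  · by_cases h3 : Γ.coreDegree x = 3
    · rw [cellValue_add, vertexSum_add, hfx x h3, vertexSum_single hyz'.1 h3, two]
    · exact vertexSum_of_coreDegree_ne_three _ hx h3

/-- A function on the cells as a function on subsets of the lattice. -/
noncomputable def cochain (g : Γ.Cell → ZMod 2) : Set (ℤ × ℤ) → ZMod 2 :=
  Function.extend (fun s : Γ.Cell => s.1) g 0

theorem cochain_apply (g : Γ.Cell → ZMod 2) (s : Γ.Cell) : cochain g s.1 = g s :=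
  Function.Injective.extend_apply Subtype.val_injective g 0 s

/-- A cycle on the curve is a cocycle on the dual subdivision: closedness at the vertices is the
triangle condition, and opposite sides of a parallelogram belong to one strand. -/
theorem isCocycle_cellValue {f : Γ.SkeletonEdge → ZMod 2}
    (hf : ∀ x, Γ.IsTriangle x → vertexSum (cellValue f) x = 0) :
    Γ.IsCocycle (cochain (cellValue f)) where
  triangle {x u v w} h hd := by
    obtain ⟨h1, h2, h3⟩ := IsTriangle.isEdge h hd
    rw [← hf x ⟨u, v, w, h, hd⟩, vertexSum_triangle (r := cellOfEdge h1) (s := cellOfEdge h2)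
      (t := cellOfEdge h3) _ h hd rfl rfl rfl]
    simp only [← cochain_apply (cellValue f)]
    rfl
  node {x u a b} h hd := by
    obtain ⟨h1, -, h2, -⟩ := IsNode.isEdge h hd
    have := cellValue_congr f (Quot.sound (continueThroughNode_of_parallelogram h hd
      (s := cellOfEdge h1) (t := cellOfEdge h2) rfl rfl))
    simp only [← cochain_apply (cellValue f)] at this
    exact this

theorem eq_of_mem_vertexSet {K K' : Graph Γ.SkeletonVertex Γ.SkeletonEdge}
    (hK : IsTwoConnectedComponent Γ.skeleton K) (hK' : IsTwoConnectedComponent Γ.skeleton K')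
    {v : Γ.SkeletonVertex} (hv : v ∈ K.vertexSet) (hv' : v ∈ K'.vertexSet) : K = K' := by
  obtain ⟨y, -, rfl⟩ := hK
  obtain ⟨z, -, rfl⟩ := hK'
  have hv : Reachable _ y v := hv
  have hv' : Reachable _ z v := hv'
  congr 1
  ext t
  exact ⟨fun h => (hv'.trans hv.symm).trans h, fun h => (hv.trans hv'.symm).trans h⟩

theorem eq_of_mem_edgeSet {K K' : Graph Γ.SkeletonVertex Γ.SkeletonEdge}
    (hK : IsTwoConnectedComponent Γ.skeleton K) (hK' : IsTwoConnectedComponent Γ.skeleton K')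
    {e : Γ.SkeletonEdge} (he : e ∈ K.edgeSet) (he' : e ∈ K'.edgeSet) : K = K' := by
  obtain ⟨v, w, h⟩ := Graph.exists_isLink_of_mem_edgeSet he
  obtain ⟨v', w', h'⟩ := Graph.exists_isLink_of_mem_edgeSet he'
  have hle : ∀ {K}, IsTwoConnectedComponent Γ.skeleton K →
      ∀ {e v w}, K.IsLink e v w → Γ.skeleton.IsLink e v w := by
    rintro _ ⟨y, -, rfl⟩ e v w ⟨h, -⟩
    exact h.mono Graph.deleteEdges_le
  rcases (hle hK h).eq_and_eq_or_eq_and_eq (hle hK' h') with ⟨rfl, rfl⟩ | ⟨rfl, rfl⟩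
  · exact eq_of_mem_vertexSet hK hK' h.left_mem h'.left_mem
  · exact eq_of_mem_vertexSet hK hK' h.left_mem h'.right_mem

/-- A trivalent point at the end of an edge of a `2`-connected component is a vertex of this
component. -/
theorem branch_mem_vertexSet {K : Graph Γ.SkeletonVertex Γ.SkeletonEdge}
    (hK : IsTwoConnectedComponent Γ.skeleton K) {e : Γ.SkeletonEdge} (he : e ∈ K.edgeSet)
    {d : Γ.Flag} (hd : Γ.IsEnd e d) : .branch d.vertex ∈ K.vertexSet := by
  obtain ⟨v, w, h⟩ := Graph.exists_isLink_of_mem_edgeSet he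
  have hle : Γ.skeleton.IsLink e v w := by
    obtain ⟨y, -, rfl⟩ := hK
    exact h.1.mono Graph.deleteEdges_le
  rcases hle with ⟨d₁, d₂, -, hset, rfl, rfl⟩ | ⟨hno, -, -⟩
  · have : d ∈ ({d₁, d₂} : Set Γ.Flag) := by rw [← hset]; exact hd
    rcases this with rfl | rfl
    · exact h.left_mem
    · exact h.right_mem
  · exact absurd hd (hno d)

theorem exists_mem_edgeSet_of_cellValue_ne_zero {f : Γ.SkeletonEdge → ZMod 2}
    {K : Graph Γ.SkeletonVertex Γ.SkeletonEdge} (hf : ∀ e, f e ≠ 0 → e ∈ K.edgeSet) {s : Γ.Cell}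
    (hs : cellValue f s ≠ 0) :
    ∃ h : ¬ Γ.IsPruned (Γ.strandOf s), Γ.skeletonEdgeOf ⟨_, h⟩ ∈ K.edgeSet := by
  by_cases h : Γ.IsPruned (Γ.strandOf s)
  · exact absurd (cellValue_of_isPruned f h) hs
  · rw [cellValue_of_core f h] at hs
    exact ⟨h, hf _ hs⟩

/-- Two cells at a triangle do not belong to different `2`-connected components. -/
theorem eq_of_triangle {K K' : Graph Γ.SkeletonVertex Γ.SkeletonEdge}
    (hK : IsTwoConnectedComponent Γ.skeleton K) (hK' : IsTwoConnectedComponent Γ.skeleton K')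
    (hx : Γ.IsTriangle x) {s t : Γ.Cell} (hsx : s.1 ⊆ Γ.argmax x) (htx : t.1 ⊆ Γ.argmax x)
    (hs : ∃ h : ¬ Γ.IsPruned (Γ.strandOf s), Γ.skeletonEdgeOf ⟨_, h⟩ ∈ K.edgeSet)
    (ht : ∃ h : ¬ Γ.IsPruned (Γ.strandOf t), Γ.skeletonEdgeOf ⟨_, h⟩ ∈ K'.edgeSet) : K = K' := by
  classical
  obtain ⟨hsp, hs⟩ := hs
  obtain ⟨htp, ht⟩ := ht
  by_cases h3 : Γ.coreDegree x = 3
  · exact eq_of_mem_vertexSet hK hK'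
      (branch_mem_vertexSet hK hs (d := ⟨x, s, hx, hsx⟩) ⟨h3, hsp, rfl⟩)
      (branch_mem_vertexSet hK' ht (d := ⟨x, t, hx, htx⟩) ⟨h3, htp, rfl⟩)
  · refine eq_of_mem_edgeSet hK hK' hs ?_
    rwa [skeletonEdgeOf_eq_of_coreDegree_ne_three hx h3 hsx htx hsp htp]

/-- At a node, a subgraph of the skeleton is represented by a cell. -/
theorem exists_cell_of_mem_image {K : Graph Γ.SkeletonVertex Γ.SkeletonEdge}
    (hK : IsTwoConnectedComponent Γ.skeleton K) (hx : Γ.IsNode x) (h : x ∈ Γ.image K) :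
    ∃ (s : Γ.Cell) (h : ¬ Γ.IsPruned (Γ.strandOf s)),
      Γ.skeletonEdgeOf ⟨Γ.strandOf s, h⟩ ∈ K.edgeSet ∧ s.1 ⊆ Γ.argmax x := by
  rcases h with h | h
  · exact h
  · obtain ⟨y, hy, rfl⟩ := hK
    -- Vertices of the skeleton named `branch` are dual to triangles, so a node can lie only on an
    -- edge.
    exfalso
    have h : Reachable _ y (.branch x) := h
    have hmem : .branch x ∈ Γ.skeleton.vertexSet := by
      rcases Relation.ReflTransGen.cases_tail h with h | ⟨z, -, hz⟩
      · rw [← h] at hy; exact hy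
      · exact (hz.mono Graph.deleteEdges_le).right_mem
    exact hx.not_isTriangle (isTriangle_of_coreDegree_eq_three hmem)

/-! ### The crossing number of two cycles is even -/

/-- The value of a potential at an end of a cell. -/
noncomputable def potentialAt (c : ℤ × ℤ → ZMod 2) (s : Γ.Cell) : ZMod 2 :=
  c s.exists_pair.choose

/-- The arbitrary choice of an end in `potentialAt` is harmless: where the weight `k` is not zero,
the potential has equal values at both ends. -/
theorem mul_potentialAt {c : ℤ × ℤ → ZMod 2} {α : Set (ℤ × ℤ) → ZMod 2}
    (hc : ∀ u v, Γ.IsEdge u v → c u + c v = α {u, v}) {s : Γ.Cell} {k : ZMod 2}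
    (hk : k ≠ 0 → α s.1 = 0) (hu : u ∈ s.1) : k * potentialAt c s = k * c u := by
  by_cases h0 : k = 0
  · rw [h0, zero_mul, zero_mul]
  have eq_of_add : ∀ y z : ZMod 2, y + z = 0 → y = z := by decide
  obtain ⟨v, hs, he⟩ := s.exists_pair.choose_spec
  have h := hc _ _ he
  rw [← hs, hk h0] at h
  rw [hs] at hu
  rcases hu with rfl | rfl
  · rfl
  · rw [← eq_of_add _ _ h]; rfl

/-- Two `2`-connected components of the skeleton that meet in a node meet in another one. -/
theorem exists_node_ne {K K' : Graph Γ.SkeletonVertex Γ.SkeletonEdge}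
    (hK : IsTwoConnectedComponent Γ.skeleton K) (hK' : IsTwoConnectedComponent Γ.skeleton K')
    (hne : K ≠ K') {p : ℝ × ℝ} (hp : Γ.IsNode p) (hpK : p ∈ Γ.image K) (hpK' : p ∈ Γ.image K') :
    ∃ q, q ≠ p ∧ Γ.IsNode q ∧ q ∈ Γ.image K ∧ q ∈ Γ.image K' := by
  classical
  have two : ∀ z : ZMod 2, z + z = 0 := by decide
  by_contra! H
  obtain ⟨s, hs, hsK, hsp⟩ := exists_cell_of_mem_image hK hp hpK
  obtain ⟨t, ht, htK, htp⟩ := exists_cell_of_mem_image hK' hp hpK'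
  obtain ⟨f, hfs, hf, hfx⟩ := exists_cycle hK hsK
  obtain ⟨g, hgt, hg, hgx⟩ := exists_cycle hK' htK
  obtain ⟨c, hc⟩ := (isCocycle_cellValue hfx).exists_potential
  have hdisj : ∀ r, cellValue g r ≠ 0 → cellValue f r = 0 := by
    intro r hr
    by_contra hr'
    obtain ⟨_, h1⟩ := exists_mem_edgeSet_of_cellValue_ne_zero hf hr'
    obtain ⟨_, h2⟩ := exists_mem_edgeSet_of_cellValue_ne_zero hg hr
    exact hne (eq_of_mem_edgeSet hK hK' h1 h2)
  have hpot : ∀ {r : Γ.Cell} {u}, u ∈ r.1 →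
      cellValue g r * potentialAt c r = cellValue g r * c u := fun {r u} hu =>
    mul_potentialAt hc (fun h => (cochain_apply _ r).trans (hdisj r h)) hu
  -- The cycle `g`, weighted by the colour of the regions along it.
  set G : Γ.Cell → ZMod 2 := fun r => cellValue g r * potentialAt c r with hG
  have hcell : ∀ {u v} {r : Γ.Cell}, r.1 = {u, v} → c u + c v = cellValue f r := by
    intro u v r hr
    rw [hc u v (Cell.isEdge hr), ← hr, cochain_apply]
  -- When a strand of `g` passes through a node, its colour changes by the value of `f` on the
  -- crossing strand; so the local sum counts the crossings of `f` and `g`.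
  have hnode : ∀ {x u a b}, Γ.argmax x = {u, u + a, u + b, u + a + b} →
      |latticeDet u (u + a) (u + b)| = 1 → ∀ {r r' : Γ.Cell}, r.1 = {u, u + a} →
      r'.1 = {u, u + b} →
      vertexSum G x = cellValue g r * cellValue f r' + cellValue g r' * cellValue f r := by
    intro x u a b h hd r r' hr hr'
    obtain ⟨-, -, h1, h2⟩ := IsNode.isEdge h hd
    obtain ⟨h', hd'⟩ := IsNode.swap h hd
    rw [vertexSum_node G h hd (r' := cellOfEdge h1) (s' := cellOfEdge h2) hr rfl hr' rfl]
    have e1 : cellValue g (cellOfEdge h1) = cellValue g r := (cellValue_congr g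
      (Quot.sound (continueThroughNode_of_parallelogram h hd hr rfl))).symm
    have e2 : cellValue g (cellOfEdge h2) = cellValue g r' := (cellValue_congr g
      (Quot.sound (continueThroughNode_of_parallelogram h' hd' hr'
        (by rw [add_right_comm u b a]; rfl)))).symm
    simp only [hG]
    rw [hpot (r := r) (u := u) (by rw [hr]; simp),
      hpot (r := cellOfEdge h1) (u := u + b) (Or.inl rfl),
      hpot (r := r') (u := u) (by rw [hr']; simp),
      hpot (r := cellOfEdge h2) (u := u + a) (Or.inl rfl), e1, e2, ← hcell hr, ← hcell hr']
    ring
  have hzero : ∀ x ∈ Γ.finite_noncollinear.toFinset, x ≠ p → vertexSum G x = 0 := by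
    intro x hx hxp
    rw [Set.Finite.mem_toFinset] at hx
    rcases Γ.nodal x hx with htri | hn
    · by_cases h0 : ∃ r : Γ.Cell, r.1 ⊆ Γ.argmax x ∧ cellValue g r ≠ 0
      · obtain ⟨r, hrx, hr⟩ := h0
        -- A triangle on `g` is not touched by `f`, so the colour is constant around it and factors
        -- out of the closedness of `g`.
        have hfzero : ∀ r : Γ.Cell, r.1 ⊆ Γ.argmax x → cellValue f r = 0 := by
          intro r' hrx'
          by_contra hr'
          exact hne (eq_of_triangle hK hK' htri hrx' hrx
            (exists_mem_edgeSet_of_cellValue_ne_zero hf hr')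
            (exists_mem_edgeSet_of_cellValue_ne_zero hg hr))
        have hsum := hgx x htri
        obtain ⟨u, v, w, h, hd⟩ := htri
        obtain ⟨h1, h2, h3⟩ := IsTriangle.isEdge h hd
        rw [vertexSum_triangle (r := cellOfEdge h1) (s := cellOfEdge h2) (t := cellOfEdge h3) _ h
          hd rfl rfl rfl] at hsum ⊢
        have huv : c u = c v := by
          have := hcell (r := cellOfEdge h1) rfl
          rw [hfzero (cellOfEdge h1) (by rw [h]; intro z hz; rcases hz with rfl | rfl <;> simp)]
            at this
          linear_combination this - two (c v)
        simp only [hG]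
        rw [hpot (r := cellOfEdge h1) (u := u) (Or.inl rfl),
          hpot (r := cellOfEdge h2) (u := u) (Or.inl rfl),
          hpot (r := cellOfEdge h3) (u := v) (Or.inl rfl), ← huv, ← add_mul, ← add_mul, hsum,
          zero_mul]
      · push Not at h0
        refine Finset.sum_eq_zero fun r hr => ?_
        simp only [Finset.mem_filter, Finset.mem_univ, true_and] at hr
        simp [hG, h0 r hr]
    · obtain ⟨u, a, b, h, hd⟩ := id hn
      obtain ⟨h1, h2, -, -⟩ := IsNode.isEdge h hd
      rw [hnode h hd (r := cellOfEdge h1) (r' := cellOfEdge h2) rfl rfl]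
      have hx1 : x ∈ Γ.cellSet (cellOfEdge h1) := by
        change (cellOfEdge h1).1 ⊆ Γ.argmax x; rw [h]; intro z hz; rcases hz with rfl | rfl <;> simp
      have hx2 : x ∈ Γ.cellSet (cellOfEdge h2) := by
        change (cellOfEdge h2).1 ⊆ Γ.argmax x; rw [h]; intro z hz; rcases hz with rfl | rfl <;> simp
      have hcross : ∀ r r' : Γ.Cell, x ∈ Γ.cellSet r → x ∈ Γ.cellSet r' →
          cellValue g r * cellValue f r' = 0 := by
        intro r r' hr hr'
        by_contra h0
        obtain ⟨h1, h1'⟩ := exists_mem_edgeSet_of_cellValue_ne_zero hg (left_ne_zero_of_mul h0)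
        obtain ⟨h2, h2'⟩ := exists_mem_edgeSet_of_cellValue_ne_zero hf (right_ne_zero_of_mul h0)
        exact H x hxp hn (Or.inl ⟨r', h2, h2', hr'⟩) (Or.inl ⟨r, h1, h1', hr⟩)
      rw [hcross _ _ hx1 hx2, hcross _ _ hx2 hx1, add_zero]
  have hone : vertexSum G p = 1 := by
    have hfs' : cellValue f s = 1 := by rw [cellValue_of_core f hs, hfs]
    have hgt' : cellValue g t = 1 := by rw [cellValue_of_core g ht, hgt]
    -- At `p` the cycle `f` runs along the strand of `s`, where `g` vanishes; so `t` belongs to the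
    -- other pair of opposite sides, and the two cycles really cross.
    have hgs : cellValue g s = 0 := by
      by_contra h0
      rw [hdisj s h0] at hfs'
      exact zero_ne_one hfs'
    obtain ⟨u, v, hsuv, he⟩ := s.exists_pair
    have hu : u ∈ Γ.argmax p := hsp (by rw [hsuv]; simp)
    have hv : v ∈ Γ.argmax p := hsp (by rw [hsuv]; simp)
    obtain ⟨a, b, h, hd, rfl⟩ : ∃ a b, Γ.argmax p = {u, u + a, u + b, u + a + b} ∧
        |latticeDet u (u + a) (u + b)| = 1 ∧ v = u + a := by
      obtain ⟨a, b, h, hd⟩ := hp.corner hu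
      rcases IsNode.eq_or_eq h hd he hv with rfl | rfl
      · exact ⟨a, b, h, hd, rfl⟩
      · obtain ⟨h', hd'⟩ := IsNode.swap h hd
        exact ⟨b, a, h', hd', rfl⟩
    obtain ⟨h1, h2, h3, h4⟩ := IsNode.isEdge h hd
    obtain ⟨h', hd'⟩ := IsNode.swap h hd
    have hgr : cellValue g (cellOfEdge h2) = 1 := by
      have e1 : cellValue g (cellOfEdge h3) = cellValue g s := (cellValue_congr g
        (Quot.sound (continueThroughNode_of_parallelogram h hd hsuv rfl))).symm
      have e2 : cellValue g (cellOfEdge h4) = cellValue g (cellOfEdge h2) := (cellValue_congr g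
        (Quot.sound (continueThroughNode_of_parallelogram h' hd' rfl
          (by rw [add_right_comm u b a]; rfl)))).symm
      have ht4 : t ∈ ({s, cellOfEdge h3, cellOfEdge h2, cellOfEdge h4} : Finset Γ.Cell) := by
        rw [← filter_cells_node h hd hsuv rfl rfl rfl]
        simpa using htp
      simp only [Finset.mem_insert, Finset.mem_singleton] at ht4
      rcases ht4 with rfl | rfl | rfl | rfl
      · exact absurd (hgs.symm.trans hgt') zero_ne_one
      · exact absurd (hgs.symm.trans (e1.symm.trans hgt')) zero_ne_one
      · exact hgt'
      · exact e2.symm.trans hgt'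
    rw [hnode h hd (r := s) (r' := cellOfEdge h2) hsuv rfl, hgs, hgr, hfs']
    simp
  have htotal := sum_vertexSum G fun r hr => by
    simp only [hG, cellValue_of_isPruned g hr, zero_mul]
  rw [Finset.sum_eq_single p hzero (fun h => absurd (by simpa using hp.not_isCollinear) h), hone]
    at htotal
  exact one_ne_zero htotal

end NodalTropicalCurve

theorem proposition3p2 (Γ : NodalTropicalCurve) (hG : IsThreeRegular Γ.skeleton)
    (Gi Gj : Graph Γ.SkeletonVertex Γ.SkeletonEdge)
    (hi : IsTwoConnectedComponent Γ.skeleton Gi) (hj : IsTwoConnectedComponent Γ.skeleton Gj)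
    (hij : Gi ≠ Gj) (p : ℝ × ℝ) (hp : Γ.IsNode p)
    (hpi : p ∈ Γ.image Gi) (hpj : p ∈ Γ.image Gj) :
    ∃ q, q ≠ p ∧ Γ.IsNode q ∧ q ∈ Γ.image Gi ∧ q ∈ Γ.image Gj :=
  NodalTropicalCurve.exists_node_ne hi hj hij hp hpi hpj
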